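/- **Theorem.** Let $Q$ be a smooth manifold of dimension $n$ (without boundary), $g$ a Riemannian metric on $Q$, $V\in C^\infty(Q)$, $L(q,v)=\tfrac12 g_q(v,v)-V(q)$, and let $H:T^*Q\to\mathbb R$ be the Legendre transform of $L$; let $\omega=dq^i\wedge dp_i$ on $T^*Q$ and $\pi:T^*Q\to Q$ the projection. For a vector field $W$ on $Q$ put $P(W)(q,p)=\langle p,W(q)\rangle$. A *natural realization* of a subset $\mathcal D^*\subset T^*Q$ is an ordered collection $\mathscr C=(P(W^1),\dots,P(W^m))$, with $W^\alpha$ smooth vector fields on $Q$, such that $\mathcal D^*=\{P(W^1)=\dots=P(W^m)=0\}$ and $0$ is a regular value of $(P(W^1),\dots,P(W^m)):T^*Q\to\mathbb R^m$. For such $\mathscr C$ let $\eta^\alpha=g(W^\alpha,\cdot)$, $m^{\alpha\beta}=g(W^\alpha,W^\beta)$, $(m_{\alpha\beta})=(m^{\alpha\beta})^{-1}$, and define the density form $$\vartheta_{\mathscr C}=m_{\alpha\beta}\,\mathcal L_{W^\alpha}\eta^\beta\in\Omega^1(Q)$$ and the nonholonomic volume $\mu_{\mathscr C}=\iota^*\varepsilon$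 on $\mathcal D^*$, where $\iota:\mathcal D^*\hookrightarrow T^*Q$ is the inclusion and $dP(W^1)\wedge\dots\wedge dP(W^m)\wedge\varepsilon=\omega^n$. Let $\mathcal D=\{v\in TQ: g(v,\cdot)\in\mathcal D^*\}$, and let $\Gamma(\mathcal D^0)$ be the set of smooth 1-forms on $Q$ annihilating $\mathcal D$. The nonholonomic vector field $X_H^{\mathcal D}$ on $\mathcal D^*$ is the vector field tangent to $\mathcal D^*$ with $i_{X_H^{\mathcal D}}\omega=dH+\pi^*\rho$ for a multiplier $\rho$ with values in $\mathcal D^0$. A *constant of motion* is a smooth function $c$ on $\mathcal D^*$ with $\mathcal L_{X_H^{\mathcal D}}c=0$. Let $\mathscr C$ and $\mathscr C'$ be two natural realizations of the same constraint $\mathcal D^*$. 1. There exists $\rho\in\Gamma(\mathcal D^0)$ such that $\vartheta_{\mathscr C}+\rho$ is exact if and only if there exists $\rho'\in\Gamma(\mathcal D^0)$ such that $\vartheta_{\mathscr C'}+\rho'$ is exact. 2. If $\rho,\rho'\in\Gamma(\mathcal D^0)$ and $f,f'\in C^\infty(Q)$ satisfy $\vartheta_{\mathscr C}+\rho=df$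 and $\vartheta_{\mathscr C'}+\rho'=df'$, then the volume forms $e^{f}\mu_{\mathscr C}$ and $e^{f'}\mu_{\mathscr C'}$ (with $f,f'$ pulled back to $\mathcal D^*$) agree up to sign modulo a constant of motion: there are a locally constant function $s:Q\to\{1,-1\}$ and a constant of motion $c$ such that $$e^{f}\,\mu_{\mathscr C}=s\,e^{c}\,e^{f'}\,\mu_{\mathscr C'}\quad\text{on }\mathcal D^*.$$ -/

import Mathlib

open Bundle
open scoped Manifold ContDiff

noncomputable section

namespace Nonholonomic

section PointwiseForms

variable {T : Type*} [AddCommGroup T] [Module ℝ T]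

/-- The wedge product of two real-valued alternating forms (the signed sum over shuffles). -/
def wedge {ι κ : Type*} [Fintype ι] [Fintype κ] [DecidableEq ι] [DecidableEq κ]
    (a : T [⋀^ι]→ₗ[ℝ] ℝ) (b : T [⋀^κ]→ₗ[ℝ] ℝ) : T [⋀^ι ⊕ κ]→ₗ[ℝ] ℝ :=
  (LinearMap.mul' ℝ ℝ).compAlternatingMap (a.domCoprod b)

/-- The `k`-fold wedge power `τ ∧ ⋯ ∧ τ` of a 2-form. -/
def wedgePow (τ : T [⋀^Fin 2]→ₗ[ℝ] ℝ) : (k : ℕ) → T [⋀^Fin (2 * k)]→ₗ[ℝ] ℝ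
  | 0 => AlternatingMap.constOfIsEmpty ℝ T (Fin 0) (1 : ℝ)
  | k + 1 => (wedge (wedgePow τ k) τ).domDomCongr finSumFinEquiv

/-- The wedge product `α₁ ∧ ⋯ ∧ αₘ` of covectors: `(v₁, …, vₘ) ↦ det (αⱼ(vᵢ))`. -/
def wedgeCovectors {m : ℕ} (α : Fin m → (T →ₗ[ℝ] ℝ)) : T [⋀^Fin m]→ₗ[ℝ] ℝ :=
  Matrix.detRowAlternating.compLinearMap (LinearMap.pi α)

/-- The 2-form `(u, v) ↦ B u v` of an alternating bilinear form `B`. -/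
def twoForm (B : T →ₗ[ℝ] T →ₗ[ℝ] ℝ) (hB : ∀ v, B v v = 0) : T [⋀^Fin 2]→ₗ[ℝ] ℝ where
  toFun v := B (v 0) (v 1)
  map_update_add' v i x y := by fin_cases i <;> simp
  map_update_smul' v i c x := by fin_cases i <;> simp
  map_eq_zero_of_eq' v i j h hij := by
    fin_cases i <;> fin_cases j <;> simp_all

end PointwiseForms

variable {E : Type*} [NormedAddCommGroup E] [NormedSpace ℝ E]
  {Q : Type*} [TopologicalSpace Q] [ChartedSpace E Q] [IsManifold 𝓘(ℝ, E) ∞ Q]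

/-! ### The cotangent bundle and its symplectic form -/

variable (E Q) in
/-- The cotangent bundle `T*Q` (phase space), with its structure of smooth vector bundle. Its points
are pairs `z = ⟨q, p⟩` with `q = z.1` and `p = z.2 : T_qQ → ℝ`. -/
abbrev CotangentBundle : Type _ :=
  TotalSpace (E →L[ℝ] ℝ) (fun q : Q => TangentSpace 𝓘(ℝ, E) q →L[ℝ] ℝ)

variable (E) in
/-- The model with corners of the manifold `T*Q`. -/
abbrev cotangentModel : ModelWithCorners ℝ (E × (E →L[ℝ] ℝ)) (ModelProd E (E →L[ℝ] ℝ)) :=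
  𝓘(ℝ, E).prod 𝓘(ℝ, E →L[ℝ] ℝ)

/-- The tangent space `T_z(T*Q)`. By definition, Mathlib's tangent space at `z` is the model space
`E × (E →L[ℝ] ℝ)`, a tangent vector being given by its components in the preferred chart at `z`. For
the cotangent bundle this is the canonical chart `(q, p)` that the chart of `Q` at `z.1` induces
(the first component is the chart of `Q`, the second one expresses a covector in the coframe
of this chart, see `hom_chart`). -/
abbrev TangentAt (z : CotangentBundle E Q) : Type _ :=
  TangentSpace (cotangentModel E) z

/-- The `∂/∂q`-components of a tangent vector of `T*Q` in the canonical chart at its base point. -/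
def qPart (z : CotangentBundle E Q) : TangentAt z →ₗ[ℝ] E :=
  LinearMap.fst ℝ E (E →L[ℝ] ℝ)

/-- The `∂/∂p`-components of a tangent vector of `T*Q` in the canonical chart at its base point. -/
def pPart (z : CotangentBundle E Q) : TangentAt z →ₗ[ℝ] (E →L[ℝ] ℝ) :=
  LinearMap.snd ℝ E (E →L[ℝ] ℝ)

/-- The canonical symplectic form `ω = dqⁱ ∧ dpᵢ` at `z`, as a bilinear form:
`ω(ξ, ζ) = dqⁱ(ξ) dpᵢ(ζ) - dqⁱ(ζ) dpᵢ(ξ)` in canonical coordinates. -/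
def symplecticBilin (z : CotangentBundle E Q) : TangentAt z →ₗ[ℝ] TangentAt z →ₗ[ℝ] ℝ :=
  LinearMap.mk₂ ℝ (fun ξ ζ => pPart z ζ (qPart z ξ) - pPart z ξ (qPart z ζ))
    (fun a b c => by simp only [map_add, add_apply]; ring)
    (fun r a b => by simp only [map_smul, smul_apply, smul_eq_mul]; ring)
    (fun a b c => by simp only [map_add, add_apply]; ring)
    (fun r a b => by simp only [map_smul, smul_apply, smul_eq_mul]; ring)

/-- The canonical symplectic form as an alternating form. -/
def symplecticForm (z : CotangentBundle E Q) : TangentAt z [⋀^Fin 2]→ₗ[ℝ] ℝ :=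
  twoForm (symplecticBilin z) (fun v => by simp [symplecticBilin])

/-- The differential of a real function on `T*Q`. -/
def dPhase (F : CotangentBundle E Q → ℝ) (z : CotangentBundle E Q) : TangentAt z →ₗ[ℝ] ℝ :=
  (mfderiv (cotangentModel E) 𝓘(ℝ, ℝ) F z).toLinearMap

/-- The differential of a real function on `Q`. -/
def dBase (f : Q → ℝ) (q : Q) : TangentSpace 𝓘(ℝ, E) q →L[ℝ] ℝ :=
  mfderiv 𝓘(ℝ, E) 𝓘(ℝ, ℝ) f q

/-- The differential of the cotangent projection `π_Q : T*Q → Q`. -/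
def dProj (z : CotangentBundle E Q) : TangentAt z →L[ℝ] TangentSpace 𝓘(ℝ, E) z.1 :=
  mfderiv (cotangentModel E) 𝓘(ℝ, E) (fun w : CotangentBundle E Q => w.1) z

/-! ### Natural realizations of a constraint -/

/-- Smoothness of a vector field on `Q`. -/
def SmoothField (W : ∀ q : Q, TangentSpace 𝓘(ℝ, E) q) : Prop :=
  ContMDiff 𝓘(ℝ, E) (𝓘(ℝ, E).prod 𝓘(ℝ, E)) ∞ (fun q => (⟨q, W q⟩ : TangentBundle 𝓘(ℝ, E) Q))

/-- Smoothness of a 1-form on `Q`. -/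
def SmoothOneForm (η : ∀ q : Q, TangentSpace 𝓘(ℝ, E) q →L[ℝ] ℝ) : Prop :=
  ContMDiff 𝓘(ℝ, E) (cotangentModel E) ∞ (fun q => (⟨q, η q⟩ : CotangentBundle E Q))

/-- The momentum `P(W)(q, p) = ⟨p, W(q)⟩` of a vector field `W`. -/
def momentum (W : ∀ q : Q, TangentSpace 𝓘(ℝ, E) q) (z : CotangentBundle E Q) : ℝ :=
  z.2 (W z.1)

/-- `{P(W¹), …, P(Wᵐ)}` is a natural realization of the constraint `S ⊆ T*Q` (the set written
`𝒟*`): `S` is the common zero set of the momenta, and `0` is a regular value of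
`G = (P(W¹), …, P(Wᵐ)) : T*Q → ℝᵐ`. -/
structure IsNaturalRealization {m : ℕ} (W : Fin m → ∀ q : Q, TangentSpace 𝓘(ℝ, E) q)
    (S : Set (CotangentBundle E Q)) : Prop where
  smooth : ∀ i, SmoothField (W i)
  eq_zeros : S = {z | ∀ i, momentum (W i) z = 0}
  regular : ∀ z ∈ S, Function.Surjective
    (mfderiv (cotangentModel E) 𝓘(ℝ, Fin m → ℝ)
      (fun w : CotangentBundle E Q => fun i => momentum (W i) w) z)

/-- The tangent space at `z ∈ S` of a closed embedded submanifold `S` of `T*Q`: the vectors that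
annihilate every smooth function vanishing on `S`. -/
def tangentTo (S : Set (CotangentBundle E Q)) (z : CotangentBundle E Q) :
    Submodule ℝ (TangentAt z) :=
  ⨅ (F : CotangentBundle E Q → ℝ) (_ : ContMDiff (cotangentModel E) 𝓘(ℝ, ℝ) ∞ F)
    (_ : ∀ w ∈ S, F w = 0), LinearMap.ker (dPhase F z)

/-- The `m`-form `σ_𝒞 = dP(W¹) ∧ ⋯ ∧ dP(Wᵐ)`. -/
def sigmaForm {m : ℕ} (W : Fin m → ∀ q : Q, TangentSpace 𝓘(ℝ, E) q) (z : CotangentBundle E Q) :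
    TangentAt z [⋀^Fin m]→ₗ[ℝ] ℝ :=
  wedgeCovectors (fun i => dPhase (momentum (W i)) z)

open Classical in
/-- The nonholonomic volume `μ_𝒞 = ι^*ε`, where `σ_𝒞 ∧ ε = ωⁿ` and `ι : S → T*Q` is the inclusion,
at a point `z ∈ S`. It is a form on `T_zS` of degree `k`, where `m + k = 2n = dim T*Q`. For a natural
realization of `S` such an `ε` exists at every point of `S`, and `ι^*ε` does not depend on its
choice. (For other values of `k` there is no such `ε` and the value is `0`.) -/
def nhVolume {m : ℕ} (W : Fin m → ∀ q : Q, TangentSpace 𝓘(ℝ, E) q)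
    (S : Set (CotangentBundle E Q)) (k : ℕ) (z : CotangentBundle E Q) :
    tangentTo S z [⋀^Fin k]→ₗ[ℝ] ℝ :=
  if h : ∃ ε : TangentAt z [⋀^Fin k]→ₗ[ℝ] ℝ, ∃ hd : m + k = 2 * Module.finrank ℝ E,
      (wedge (sigmaForm W z) ε).domDomCongr (finSumFinEquiv.trans (finCongr hd)) =
        wedgePow (symplecticForm z) (Module.finrank ℝ E)
  then h.choose.compLinearMap (tangentTo S z).subtype
  else 0

/-! ### The density form -/

variable (E Q) in
/-- Smooth Riemannian metrics on `Q`. -/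
abbrev Metric : Type _ :=
  ContMDiffRiemannianMetric 𝓘(ℝ, E) ∞ E (fun q : Q => TangentSpace 𝓘(ℝ, E) q)

/-- The 1-form `W^♭ = g(W, ·)`. -/
def flatForm (g : Metric E Q) (W : ∀ q : Q, TangentSpace 𝓘(ℝ, E) q) (q : Q) :
    TangentSpace 𝓘(ℝ, E) q →L[ℝ] ℝ :=
  g.inner q (W q)

/-- The Lie derivative `L_W η` of a 1-form along a vector field. In the coordinates of the preferred
chart at `q` it is `(Wⁱ ∂ᵢηⱼ + ηᵢ ∂ⱼWⁱ) dxʲ`; the components of `η` and `W` near `q` in these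
coordinates are given by the trivializations of `T*Q` and `TQ` at `q`. -/
def lieDeriv (W : ∀ q : Q, TangentSpace 𝓘(ℝ, E) q)
    (η : ∀ q : Q, TangentSpace 𝓘(ℝ, E) q →L[ℝ] ℝ) (q : Q) : TangentSpace 𝓘(ℝ, E) q →L[ℝ] ℝ :=
  let ηc : Q → (E →L[ℝ] ℝ) := fun x => (trivializationAt (E →L[ℝ] ℝ)
    (fun y : Q => TangentSpace 𝓘(ℝ, E) y →L[ℝ] ℝ) q ⟨x, η x⟩).2
  let Wc : Q → E := fun x => (trivializationAt E (TangentSpace 𝓘(ℝ, E) (M := Q)) q ⟨x, W x⟩).2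
  let Dη : TangentSpace 𝓘(ℝ, E) q →L[ℝ] (TangentSpace 𝓘(ℝ, E) q →L[ℝ] ℝ) :=
    mfderiv 𝓘(ℝ, E) 𝓘(ℝ, E →L[ℝ] ℝ) ηc q
  let DW : TangentSpace 𝓘(ℝ, E) q →L[ℝ] TangentSpace 𝓘(ℝ, E) q := mfderiv 𝓘(ℝ, E) 𝓘(ℝ, E) Wc q
  Dη (W q) + (η q).comp DW

/-- The constraint mass matrix `m^{αβ} = g(W^α, W^β)`. -/
def massMatrix (g : Metric E Q) {m : ℕ} (W : Fin m → ∀ q : Q, TangentSpace 𝓘(ℝ, E) q) (q : Q) :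
    Matrix (Fin m) (Fin m) ℝ :=
  Matrix.of fun a b => g.inner q (W a q) (W b q)

/-- The density form `ϑ_𝒞 = m_{αβ} L_{W^α} η^β`, where `(m_{αβ})` is the inverse of the mass matrix
and `η^β = g(W^β, ·)`. -/
def densityForm (g : Metric E Q) {m : ℕ} (W : Fin m → ∀ q : Q, TangentSpace 𝓘(ℝ, E) q) (q : Q) :
    TangentSpace 𝓘(ℝ, E) q →L[ℝ] ℝ :=
  ∑ a, ∑ b, (massMatrix g W q)⁻¹ a b • lieDeriv (W a) (flatForm g (W b)) q

/-- The constraint distribution on the tangent side: `𝒟_q = {v ∈ T_qQ : g(v, ·) ∈ S}`. -/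
def distribution (g : Metric E Q) (S : Set (CotangentBundle E Q)) (q : Q) :
    Set (TangentSpace 𝓘(ℝ, E) q) :=
  {v | (⟨q, g.inner q v⟩ : CotangentBundle E Q) ∈ S}

/-- `ρ ∈ Γ(𝒟⁰)`: a smooth 1-form annihilating the distribution. -/
def IsAnnihilatorSection (g : Metric E Q) (S : Set (CotangentBundle E Q))
    (ρ : ∀ q : Q, TangentSpace 𝓘(ℝ, E) q →L[ℝ] ℝ) : Prop :=
  SmoothOneForm ρ ∧ ∀ q, ∀ v ∈ distribution g S q, ρ q v = 0

/-- `α = df` for the smooth function `f`. -/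
def IsPrimitive (f : Q → ℝ) (α : ∀ q : Q, TangentSpace 𝓘(ℝ, E) q →L[ℝ] ℝ) : Prop :=
  ContMDiff 𝓘(ℝ, E) 𝓘(ℝ, ℝ) ∞ f ∧ ∀ q, α q = dBase f q

/-- The 1-form `α` is exact. -/
def IsExactForm (α : ∀ q : Q, TangentSpace 𝓘(ℝ, E) q →L[ℝ] ℝ) : Prop :=
  ∃ f : Q → ℝ, IsPrimitive f α

/-! ### The nonholonomic dynamics -/

/-- The natural Lagrangian `L(q, v) = ½ g_q(v, v) - V(q)`. -/
def lagrangian (g : Metric E Q) (V : Q → ℝ) (q : Q) (v : TangentSpace 𝓘(ℝ, E) q) : ℝ :=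
  (1 / 2) * g.inner q v v - V q

variable [FiniteDimensional ℝ E]

/-- The fiber derivative `𝔽L : T_qQ → T_q^*Q`, `v ↦ g_q(v, ·)`. -/
def fiberDeriv (g : Metric E Q) (q : Q) :
    TangentSpace 𝓘(ℝ, E) q ≃ₗ[ℝ] (TangentSpace 𝓘(ℝ, E) q →L[ℝ] ℝ) :=
  LinearEquiv.ofBijective (g.inner q).toLinearMap (by
    have hinj : Function.Injective (g.inner q).toLinearMap := by
      rw [← LinearMap.ker_eq_bot, LinearMap.ker_eq_bot']
      intro v hv
      by_contra hne
      have h1 := g.pos q v hne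
      have h2 : g.inner q v v = 0 := by
        have := congrArg (fun φ : TangentSpace 𝓘(ℝ, E) q →L[ℝ] ℝ => φ v) hv
        simpa using this
      exact h1.ne' h2
    have : FiniteDimensional ℝ (TangentSpace 𝓘(ℝ, E) q) := inferInstanceAs (FiniteDimensional ℝ E)
    have : FiniteDimensional ℝ (TangentSpace 𝓘(ℝ, E) q →L[ℝ] ℝ) :=
      inferInstanceAs (FiniteDimensional ℝ (E →L[ℝ] ℝ))
    have hdim : Module.finrank ℝ (TangentSpace 𝓘(ℝ, E) q) =
        Module.finrank ℝ (TangentSpace 𝓘(ℝ, E) q →L[ℝ] ℝ) := by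
      have e : (E →ₗ[ℝ] ℝ) ≃ₗ[ℝ] (E →L[ℝ] ℝ) := LinearMap.toContinuousLinearMap
      exact (Subspace.dual_finrank_eq (K := ℝ) (V := E)).symm.trans e.finrank_eq
    exact ⟨hinj, (LinearMap.injective_iff_surjective_of_finrank_eq_finrank hdim).1 hinj⟩)

/-- The natural Hamiltonian: the Legendre transform `H(q, p) = ⟨p, v⟩ - L(q, v)`, `p = 𝔽L(v)`. -/
def hamiltonian (g : Metric E Q) (V : Q → ℝ) (z : CotangentBundle E Q) : ℝ :=
  z.2 ((fiberDeriv g z.1).symm z.2) - lagrangian g V z.1 ((fiberDeriv g z.1).symm z.2)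

/-- `X = X_H^𝒟(z)`, the value at `z ∈ S` of the nonholonomic vector field: `X` is tangent to `S` and
`i_X ω = dH + π_Q^*ρ` at `z` for a constraint force `ρ ∈ 𝒟⁰` at `z.1`. -/
def IsNonholonomicVector (g : Metric E Q) (V : Q → ℝ) (S : Set (CotangentBundle E Q))
    (z : CotangentBundle E Q) (X : TangentAt z) : Prop :=
  X ∈ tangentTo S z ∧
    ∃ ρ : TangentSpace 𝓘(ℝ, E) z.1 →L[ℝ] ℝ, (∀ v ∈ distribution g S z.1, ρ v = 0) ∧
      ∀ ξ : TangentAt z, symplecticBilin z X ξ = dPhase (hamiltonian g V) z ξ + ρ (dProj z ξ)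

/-- The restriction of `c` to `S` is a constant of motion: its derivative along the nonholonomic
vector field vanishes on `S`. -/
def IsConstantOfMotion (g : Metric E Q) (V : Q → ℝ) (S : Set (CotangentBundle E Q))
    (c : CotangentBundle E Q → ℝ) : Prop :=
  ∀ z ∈ S, ∀ X : TangentAt z, IsNonholonomicVector g V S z X → dPhase c z X = 0

end Nonholonomic

end

noncomputable section

namespace Nonholonomic

open Topology

/-! ### Wedge products of forms on a single vector space -/

section WedgeAlgebra

variable {T : Type*} [AddCommGroup T] [Module ℝ T]
  {ι κ : Type*} [Fintype ι] [Fintype κ] [DecidableEq ι] [DecidableEq κ]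

/-! Everything reduces to comparing two frames of the same bundle. The momenta are linear in `p`, so
regularity on the zero section makes the `W i` pointwise independent, and on each fibre `S` is the
annihilator of their span. Two realizations of `S` therefore span the same subspaces and `W' = A W`
with `A` smooth and invertible (`sum_frameMatrix_smul`, `det_frameMatrix_ne_zero`); in particular `m
= m'` unless `Q` is empty.

Density forms: the mass matrices satisfy `M' = A M Aᵀ`. Expand `L_{W'}η'` by the Leibniz rule and
contract with `M'⁻¹`. The Lie derivative terms reassemble to `ϑ`, the terms in `dA` give `tr(A⁻¹ dA)
= d log |det A|`, and the rest is a combination of the forms `g(W j, ·)`, which annihilate `𝒟`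
(`densityForm_frameChange`). Exactness modulo `Γ(𝒟⁰)` is thus independent of the realization.

Volumes: on `S` the momenta vanish, so `dP(W') = A dP(W)` there and `μ = det A • μ'`
(`nhVolume_frameChange`). Writing `det A = s e^{log |det A|}` with `s` its sign leaves `c = f + log
|det A| - f'`. Its differential lies in `𝒟⁰`, and the nonholonomic vector at `(q, p)` projects to
the velocity `g⁻¹p`, which lies in `𝒟` when `(q, p) ∈ S`; so `c` is a constant of motion
(`isConstantOfMotion_comp_proj`). -/

theorem wedge_smul_left (r : ℝ) (a : T [⋀^ι]→ₗ[ℝ] ℝ) (b : T [⋀^κ]→ₗ[ℝ] ℝ) :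
    wedge (r • a) b = r • wedge a b := by
  ext v
  have h : (r • a).domCoprod b = r • a.domCoprod b := by
    rw [← AlternatingMap.domCoprod'_apply, ← AlternatingMap.domCoprod'_apply,
      ← TensorProduct.smul_tmul', map_smul]
  simp [wedge, h]

theorem wedge_smul_right (r : ℝ) (a : T [⋀^ι]→ₗ[ℝ] ℝ) (b : T [⋀^κ]→ₗ[ℝ] ℝ) :
    wedge a (r • b) = r • wedge a b := by
  ext v
  have h : a.domCoprod (r • b) = r • a.domCoprod b := by
    rw [← AlternatingMap.domCoprod'_apply, ← AlternatingMap.domCoprod'_apply,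
      TensorProduct.tmul_smul, map_smul]
  simp [wedge, h]

theorem wedge_add_right (a : T [⋀^ι]→ₗ[ℝ] ℝ) (b c : T [⋀^κ]→ₗ[ℝ] ℝ) :
    wedge a (b + c) = wedge a b + wedge a c := by
  ext v
  have h : a.domCoprod (b + c) = a.domCoprod b + a.domCoprod c := by
    simp only [← AlternatingMap.domCoprod'_apply, TensorProduct.tmul_add, map_add]
  simp [wedge, h]

/-- If `a` vanishes as soon as one of its arguments is one of the vectors `v j`, then only the
trivial shuffle contributes to `(a ∧ b)(u, v)`. -/
theorem wedge_apply_sumElim (a : T [⋀^ι]→ₗ[ℝ] ℝ) (b : T [⋀^κ]→ₗ[ℝ] ℝ) (u : ι → T) (v : κ → T)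
    (hv : ∀ (w : ι → T) (i : ι) (j : κ), w i = v j → a w = 0) :
    wedge a b (Sum.elim u v) = a u * b v := by
  simp only [wedge, LinearMap.compAlternatingMap_apply, AlternatingMap.domCoprod_apply,
    _root_.sum_apply, map_sum]
  refine (Finset.sum_eq_single
    (Quotient.mk'' (1 : Equiv.Perm (ι ⊕ κ)) : Equiv.Perm.ModSumCongr ι κ) ?_ ?_).trans ?_
  · intro σ _ hσ
    induction σ using Quotient.inductionOn' with
    | _ σ =>
      have hex : ∃ i j, σ (Sum.inl i) = Sum.inr j := by
        by_contra! hne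
        refine hσ (Quotient.sound' ?_)
        rw [QuotientGroup.leftRel_apply, mul_one]
        refine Subgroup.inv_mem _ (Equiv.Perm.mem_sumCongrHom_range_of_perm_mapsTo_inl ?_)
        rintro _ ⟨i, rfl⟩
        rcases h : σ (Sum.inl i) with k | k
        · exact ⟨k, rfl⟩
        · exact absurd h (hne i k)
      obtain ⟨i, j, hij⟩ := hex
      simp [AlternatingMap.domCoprod.summand_mk'', hv (fun i => Sum.elim u v (σ (Sum.inl i))) i j
        (by simp [hij])]
  · intro h
    exact absurd (Finset.mem_univ _) h
  · rw [AlternatingMap.domCoprod.summand_mk'']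
    simp

theorem wedgeCovectors_apply {m : ℕ} (α : Fin m → (T →ₗ[ℝ] ℝ)) (v : Fin m → T) :
    wedgeCovectors α v = (Matrix.of fun i j => α j (v i)).det := rfl

theorem wedgeCovectors_sum_smul {m : ℕ} (A : Matrix (Fin m) (Fin m) ℝ)
    (α : Fin m → (T →ₗ[ℝ] ℝ)) :
    wedgeCovectors (fun i => ∑ j, A i j • α j) = A.det • wedgeCovectors α := by
  ext v
  have h : (Matrix.of fun i j => (∑ k, A j k • α k) (v i)) =
      (Matrix.of fun i j => α j (v i)) * A.transpose := by
    ext i j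
    simp [Matrix.mul_apply, mul_comm]
  rw [wedgeCovectors_apply, h, Matrix.det_mul, Matrix.det_transpose, AlternatingMap.smul_apply,
    wedgeCovectors_apply, smul_eq_mul, mul_comm]

/-- A form `ε` with `(α₁ ∧ ⋯ ∧ αₘ) ∧ ε = 0`, where the `αᵢ` are linearly independent, vanishes on
the common kernel of the `αᵢ`. -/
theorem apply_eq_zero_of_wedgeCovectors_wedge_eq_zero {m : ℕ} (α : Fin m → (T →ₗ[ℝ] ℝ))
    (hα : Function.Surjective (LinearMap.pi α)) (ε : T [⋀^κ]→ₗ[ℝ] ℝ)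
    (h : wedge (wedgeCovectors α) ε = 0) (v : κ → T) (hv : ∀ i j, α i (v j) = 0) : ε v = 0 := by
  choose u hu using fun i : Fin m => hα (Pi.single i 1)
  have h1 : wedge (wedgeCovectors α) ε (Sum.elim u v) = 0 := by rw [h]; rfl
  rw [wedge_apply_sumElim] at h1
  · have h2 : (Matrix.of fun i j => α j (u i)) = 1 := by
      ext i j
      have := congrFun (hu i) j
      simp only [LinearMap.pi_apply] at this
      rw [Matrix.of_apply, this, Matrix.one_apply, Pi.single_apply]
      simp [eq_comm]
    rwa [wedgeCovectors_apply, h2, Matrix.det_one, one_mul] at h1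
  · intro w i j hij
    rw [wedgeCovectors_apply]
    refine Matrix.det_eq_zero_of_row_eq_zero i fun k => ?_
    simp [hij, hv]

end WedgeAlgebra

/-! ### Derivative of the determinant -/

section Jacobi

variable {E' H M : Type*} [NormedAddCommGroup E'] [NormedSpace ℝ E'] [TopologicalSpace H]
  {I : ModelWithCorners ℝ E' H} [TopologicalSpace M] [ChartedSpace H M]

theorem hasMFDerivAt_pi {ι F : Type*} [Fintype ι] [NormedAddCommGroup F] [NormedSpace ℝ F]
    {f : ι → M → F} {q : M} {f' : ι → (TangentSpace I q →L[ℝ] F)}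
    (hf : ∀ i, HasMFDerivAt I 𝓘(ℝ, F) (f i) q (f' i)) :
    HasMFDerivAt I 𝓘(ℝ, ι → F) (fun x i => f i x) q
      (ContinuousLinearMap.pi f' : TangentSpace I q →L[ℝ] (ι → F)) :=
  ⟨continuousAt_pi.2 fun i => (hf i).1, hasFDerivWithinAt_pi.2 fun i => (hf i).2⟩

/-- Jacobi's formula `d(det A) = tr(adj(A) dA)`. -/
theorem exists_hasFDerivAt_det {m : ℕ} (A : Fin m → Fin m → ℝ) :
    ∃ L : (Fin m → Fin m → ℝ) →L[ℝ] ℝ,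
      HasFDerivAt (fun B : Fin m → Fin m → ℝ => (Matrix.of B).det) L A ∧
        ∀ X, L X = ∑ i, ∑ j, (Matrix.of A).adjugate j i * X i j := by
  let D : ContinuousMultilinearMap ℝ (fun _ : Fin m => Fin m → ℝ) ℝ :=
    ⟨(Matrix.detRowAlternating (R := ℝ) (n := Fin m)).toMultilinearMap,
      (continuous_id (X := Matrix (Fin m) (Fin m) ℝ)).matrix_det⟩
  refine ⟨_, D.hasFDerivAt A, fun X => ?_⟩
  rw [ContinuousMultilinearMap.linearDeriv_apply]
  refine Finset.sum_congr rfl fun i _ => ?_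
  -- The derivative of a multilinear map replaces one row at a time; Cramer's rule turns each such
  -- determinant into a row of cofactors paired with `X i`.
  change ((Matrix.of A).updateRow i (X i)).det = _
  rw [← Matrix.cramer_transpose_apply, Matrix.cramer_eq_adjugate_mulVec,
    ← Matrix.adjugate_transpose]
  simp [Matrix.mulVec, dotProduct]

theorem hasMFDerivAt_det {m : ℕ} {A : M → Matrix (Fin m) (Fin m) ℝ} {q : M}
    {A' : Fin m → Fin m → (TangentSpace I q →L[ℝ] ℝ)}
    (hA : ∀ i j, HasMFDerivAt I 𝓘(ℝ, ℝ) (fun x => A x i j) q (A' i j)) :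
    HasMFDerivAt I 𝓘(ℝ, ℝ) (fun x => (A x).det) q
      (∑ i, ∑ j, (A q).adjugate j i • A' i j : TangentSpace I q →L[ℝ] ℝ) := by
  obtain ⟨L, hL, hLX⟩ := exists_hasFDerivAt_det (A q)
  have hp := hasMFDerivAt_pi fun i => hasMFDerivAt_pi fun j => hA i j
  refine (HasMFDerivAt.comp q (g := fun B : Fin m → Fin m → ℝ => (Matrix.of B).det)
    hL.hasMFDerivAt hp).congr_mfderiv ?_
  refine ContinuousLinearMap.ext fun v => ?_
  refine (hLX _).trans ?_
  change _ = (∑ i, ∑ j, (A q).adjugate j i • A' i j : TangentSpace I q →L[ℝ] ℝ) v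
  rw [_root_.sum_apply]
  refine Finset.sum_congr rfl fun i _ => ?_
  rw [_root_.sum_apply]
  rfl

end Jacobi

/-! ### Product rules for maps from a manifold to normed spaces -/

section Calculus

variable {E' H M : Type*} [NormedAddCommGroup E'] [NormedSpace ℝ E'] [TopologicalSpace H]
  {I : ModelWithCorners ℝ E' H} [TopologicalSpace M] [ChartedSpace H M]

theorem hasMFDerivAt_clm_apply {F G : Type*} [NormedAddCommGroup F] [NormedSpace ℝ F]
    [NormedAddCommGroup G] [NormedSpace ℝ G]
    {c : M → (F →L[ℝ] G)} {u : M → F} {q : M} {c' : E' →L[ℝ] (F →L[ℝ] G)} {u' : E' →L[ℝ] F}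
    (hc : HasMFDerivAt I 𝓘(ℝ, F →L[ℝ] G) c q c') (hu : HasMFDerivAt I 𝓘(ℝ, F) u q u') :
    HasMFDerivAt I 𝓘(ℝ, G) (fun x => c x (u x)) q
      ((c q).comp u' + c'.flip (u q) : E' →L[ℝ] G) := by
  have hp : HasMFDerivAt I 𝓘(ℝ, (F →L[ℝ] G) × F) (fun x => (c x, u x)) q (c'.prod u') :=
    ⟨hc.1.prodMk hu.1, hc.2.prodMk hu.2⟩
  exact (isBoundedBilinearMap_apply.hasFDerivAt (c q, u q)).hasMFDerivAt.comp q hp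

theorem hasMFDerivAt_smul {G : Type*} [NormedAddCommGroup G] [NormedSpace ℝ G]
    {c : M → ℝ} {u : M → G} {q : M} {c' : TangentSpace I q →L[ℝ] ℝ}
    {u' : TangentSpace I q →L[ℝ] G}
    (hc : HasMFDerivAt I 𝓘(ℝ, ℝ) c q c') (hu : HasMFDerivAt I 𝓘(ℝ, G) u q u') :
    HasMFDerivAt I 𝓘(ℝ, G) (fun x => c x • u x) q
      (c q • u' + c'.smulRight (u q) : TangentSpace I q →L[ℝ] G) := by
  have hp : HasMFDerivAt I 𝓘(ℝ, ℝ × G) (fun x => (c x, u x)) q (c'.prod u') :=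
    ⟨hc.1.prodMk hu.1, hc.2.prodMk hu.2⟩
  exact (isBoundedBilinearMap_smul.hasFDerivAt (c q, u q)).hasMFDerivAt.comp q hp

theorem hasMFDerivAt_sum {ι G : Type*} {s : Finset ι} [NormedAddCommGroup G] [NormedSpace ℝ G]
    {u : ι → M → G} {q : M} {u' : ι → (TangentSpace I q →L[ℝ] G)}
    (hu : ∀ i ∈ s, HasMFDerivAt I 𝓘(ℝ, G) (u i) q (u' i)) :
    HasMFDerivAt I 𝓘(ℝ, G) (fun x => ∑ i ∈ s, u i x) q
      (∑ i ∈ s, u' i : TangentSpace I q →L[ℝ] G) :=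
  ⟨tendsto_finsetSum _ fun i hi => (hu i hi).1,
    HasFDerivWithinAt.fun_sum fun i hi => (hu i hi).2⟩

end Calculus

/-! ### Canonical charts of `TQ` and `T*Q`, and smoothness of sections -/

variable {E : Type*} [NormedAddCommGroup E] [NormedSpace ℝ E]
  {Q : Type*} [TopologicalSpace Q] [ChartedSpace E Q] [IsManifold 𝓘(ℝ, E) ∞ Q]

/-- The cotangent trivialization is contragredient to the tangent one, so the pairing can be
computed in coordinates anywhere in the chart domain. -/
theorem cotangent_trivialization_apply {q x : Q} (hx : x ∈ (chartAt E q).source)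
    (p : TangentSpace 𝓘(ℝ, E) x →L[ℝ] ℝ) (v : TangentSpace 𝓘(ℝ, E) x) :
    (trivializationAt (E →L[ℝ] ℝ) (fun y : Q => TangentSpace 𝓘(ℝ, E) y →L[ℝ] ℝ) q ⟨x, p⟩).2
      (trivializationAt E (TangentSpace 𝓘(ℝ, E) (M := Q)) q ⟨x, v⟩).2 = p v := by
  have hx' : x ∈ (trivializationAt E (TangentSpace 𝓘(ℝ, E) (M := Q)) q).baseSet := hx
  rw [hom_trivializationAt_apply]
  have hx2 : x ∈ (trivializationAt ℝ (Bundle.Trivial Q ℝ) q).baseSet := Set.mem_univ _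
  have h := ContinuousLinearMap.inCoordinates_eq (σ := RingHom.id ℝ) (F := E) (F' := ℝ)
    (E := TangentSpace 𝓘(ℝ, E) (M := Q)) (E' := Bundle.Trivial Q ℝ) (ϕ := p) hx' hx2
  refine (congrArg (fun L : E →L[ℝ] ℝ =>
    L (trivializationAt E (TangentSpace 𝓘(ℝ, E) (M := Q)) q ⟨x, v⟩).2) h).trans ?_
  simp only [ContinuousLinearMap.comp_apply]
  have e : ((trivializationAt E (TangentSpace 𝓘(ℝ, E) (M := Q)) q).continuousLinearEquivAt
      ℝ x hx').symm (trivializationAt E (TangentSpace 𝓘(ℝ, E) (M := Q)) q ⟨x, v⟩).2 = v := by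
    rw [ContinuousLinearEquiv.symm_apply_eq]
    rfl
  erw [e]
  rfl

theorem tangent_trivialization_self (q : Q) (v : TangentSpace 𝓘(ℝ, E) q) :
    (trivializationAt E (TangentSpace 𝓘(ℝ, E) (M := Q)) q ⟨q, v⟩).2 = v := by
  have : IsManifold 𝓘(ℝ, E) 1 Q := IsManifold.of_le (n := ∞) (by norm_cast)
  exact tangentCoordChange_self (I := 𝓘(ℝ, E)) (mem_extChartAt_source q)

theorem cotangent_trivialization_self (q : Q) (p : TangentSpace 𝓘(ℝ, E) q →L[ℝ] ℝ) :
    (trivializationAt (E →L[ℝ] ℝ) (fun y : Q => TangentSpace 𝓘(ℝ, E) y →L[ℝ] ℝ) q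
      ⟨q, p⟩).2 = p := by
  refine ContinuousLinearMap.ext fun v => ?_
  have h := cotangent_trivialization_apply (mem_chart_source E q) p v
  exact (congrArg _ (tangent_trivialization_self q v)).symm.trans h

theorem hasMFDerivAt_proj (z : CotangentBundle E Q) :
    HasMFDerivAt (cotangentModel E) 𝓘(ℝ, E) (fun w : CotangentBundle E Q => w.1) z
      (ContinuousLinearMap.fst ℝ E (E →L[ℝ] ℝ) : TangentAt z →L[ℝ] TangentSpace 𝓘(ℝ, E) z.1) := by
  refine ⟨(FiberBundle.continuous_proj _ _).continuousAt, ?_⟩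
  have key : ∀ y ∈ (extChartAt (cotangentModel E) z).target,
      writtenInExtChartAt (cotangentModel E) 𝓘(ℝ, E) z (fun w : CotangentBundle E Q => w.1) y
        = y.1 := by
    intro y hy
    have h := (extChartAt (cotangentModel E) z).right_inv hy
    rw [FiberBundle.extChartAt] at h
    have h1 := congrArg Prod.fst h
    simp only [writtenInExtChartAt, Function.comp_apply]
    rw [FiberBundle.extChartAt]
    exact h1
  refine HasFDerivWithinAt.congr_of_eventuallyEq hasFDerivWithinAt_fst ?_
    (key _ (mem_extChartAt_target z))
  filter_upwards [extChartAt_target_mem_nhdsWithin z] with y hy using key y hy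

/-- In the canonical chart at `z` the fibre through `z` is parametrized by `p` itself, because the
trivialization is the identity over its own base point. -/
theorem hasMFDerivAt_fiber (z : CotangentBundle E Q) :
    HasMFDerivAt 𝓘(ℝ, E →L[ℝ] ℝ) (cotangentModel E)
      (fun p : E →L[ℝ] ℝ => (⟨z.1, p⟩ : CotangentBundle E Q)) z.2
      (ContinuousLinearMap.inr ℝ E (E →L[ℝ] ℝ) : (E →L[ℝ] ℝ) →L[ℝ] TangentAt z) := by
  have key : ∀ p : E →L[ℝ] ℝ, (extChartAt (cotangentModel E) z) ⟨z.1, p⟩ =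
     (extChartAt 𝓘(ℝ, E) z.1 z.1, p) := by
    intro p
    rw [FiberBundle.extChartAt]
    exact congrArg (Prod.mk _) (cotangent_trivialization_self z.1 p)
  refine ⟨(FiberBundle.continuous_totalSpaceMk _ _ z.1).continuousAt, ?_⟩
  have h : HasFDerivWithinAt (fun p : E →L[ℝ] ℝ => (extChartAt 𝓘(ℝ, E) z.1 z.1, p))
    (ContinuousLinearMap.inr ℝ E (E →L[ℝ] ℝ)) (Set.range 𝓘(ℝ, E →L[ℝ] ℝ)) z.2 :=
    (hasFDerivAt_prodMk_right _ _).hasFDerivWithinAt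
  exact h.congr (fun p _ => key p) (key _)

theorem dProj_apply (z : CotangentBundle E Q) (X : TangentAt z) : dProj z X = qPart z X := by
  rw [dProj, (hasMFDerivAt_proj z).mfderiv]; rfl

theorem SmoothField.contMDiff_momentum {W : ∀ q : Q, TangentSpace 𝓘(ℝ, E) q} (hW : SmoothField W) :
    ContMDiff (cotangentModel E) 𝓘(ℝ, ℝ) ∞ (momentum W) := by
  intro z
  have : ContMDiffAt (cotangentModel E) (𝓘(ℝ, E).prod 𝓘(ℝ, ℝ)) ∞
      (fun z : CotangentBundle E Q =>
        TotalSpace.mk' ℝ (E := Bundle.Trivial Q ℝ) z.1 (z.2 (W z.1))) z := by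
    apply ContMDiffAt.clm_bundle_apply (F₁ := E)
    · exact contMDiffAt_id
    · exact hW.contMDiffAt.comp z (contMDiff_proj _).contMDiffAt
  exact (contMDiffAt_totalSpace.1 this).2

theorem SmoothField.smoothOneForm_flatForm (g : Metric E Q)
    {W : ∀ q : Q, TangentSpace 𝓘(ℝ, E) q} (hW : SmoothField W) : SmoothOneForm (flatForm g W) := by
  intro z
  exact ContMDiffAt.clm_bundle_apply (F₁ := E) (F₂ := E →L[ℝ] ℝ)
    (E₂ := fun q : Q => TangentSpace 𝓘(ℝ, E) q →L[ℝ] ℝ) g.contMDiff.contMDiffAt hW.contMDiffAt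

theorem contMDiff_oneForm_apply {η : ∀ q : Q, TangentSpace 𝓘(ℝ, E) q →L[ℝ] ℝ}
    (hη : SmoothOneForm η) {W : ∀ q : Q, TangentSpace 𝓘(ℝ, E) q} (hW : SmoothField W) :
    ContMDiff 𝓘(ℝ, E) 𝓘(ℝ, ℝ) ∞ (fun q => η q (W q)) :=
  hW.contMDiff_momentum.comp hη

theorem contMDiff_inner (g : Metric E Q) {W W' : ∀ q : Q, TangentSpace 𝓘(ℝ, E) q}
    (hW : SmoothField W) (hW' : SmoothField W') :
    ContMDiff 𝓘(ℝ, E) 𝓘(ℝ, ℝ) ∞ (fun q => g.inner q (W q) (W' q)) :=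
  contMDiff_oneForm_apply (hW.smoothOneForm_flatForm g) hW'

/-- The function is the fibre component of the tangent map of `f` composed with the section `W`. -/
theorem contMDiff_dBase_apply {f : Q → ℝ} (hf : ContMDiff 𝓘(ℝ, E) 𝓘(ℝ, ℝ) ∞ f)
    {W : ∀ q : Q, TangentSpace 𝓘(ℝ, E) q} (hW : SmoothField W) :
    ContMDiff 𝓘(ℝ, E) 𝓘(ℝ, ℝ) ∞ (fun q => dBase f q (W q)) := by
  have : IsManifold 𝓘(ℝ, E) 1 Q := IsManifold.of_le (n := ∞) (by norm_cast)
  have h := (hf.contMDiff_tangentMap (m := ∞) (by simp)).comp hW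
  exact (contMDiff_snd_tangentBundle_modelSpace ℝ 𝓘(ℝ, ℝ)).comp h

theorem SmoothOneForm.sum_smul {ι : Type*} {s : Finset ι} {a : ι → Q → ℝ}
    {η : ι → ∀ q : Q, TangentSpace 𝓘(ℝ, E) q →L[ℝ] ℝ}
    (ha : ∀ i ∈ s, ContMDiff 𝓘(ℝ, E) 𝓘(ℝ, ℝ) ∞ (a i)) (h : ∀ i ∈ s, SmoothOneForm (η i)) :
    SmoothOneForm (fun q => ∑ i ∈ s, a i q • η i q) :=
  ContMDiff.sum_section fun i hi => (ha i hi).smul_section (h i hi)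

/-! ### Coordinate components and the Leibniz rule for the Lie derivative -/

/-- The components of a 1-form in the coordinates of the preferred chart at `q`. -/
abbrev formCoord (q : Q) (η : ∀ q : Q, TangentSpace 𝓘(ℝ, E) q →L[ℝ] ℝ) (x : Q) : E →L[ℝ] ℝ :=
  (trivializationAt (E →L[ℝ] ℝ) (fun y : Q => TangentSpace 𝓘(ℝ, E) y →L[ℝ] ℝ) q ⟨x, η x⟩).2

/-- The components of a vector field in the coordinates of the preferred chart at `q`. -/
abbrev fieldCoord (q : Q) (W : ∀ q : Q, TangentSpace 𝓘(ℝ, E) q) (x : Q) : E :=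
  (trivializationAt E (TangentSpace 𝓘(ℝ, E) (M := Q)) q ⟨x, W x⟩).2

theorem SmoothField.mdifferentiableAt {W : ∀ q : Q, TangentSpace 𝓘(ℝ, E) q}
    (hW : SmoothField W) (q : Q) :
    MDifferentiableAt 𝓘(ℝ, E) 𝓘(ℝ, E) (fieldCoord q W) q :=
  ((contMDiffAt_totalSpace.1 hW.contMDiffAt).2).mdifferentiableAt (by simp)

theorem SmoothOneForm.mdifferentiableAt {η : ∀ q : Q, TangentSpace 𝓘(ℝ, E) q →L[ℝ] ℝ}
    (hη : SmoothOneForm η) (q : Q) :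
    MDifferentiableAt 𝓘(ℝ, E) 𝓘(ℝ, E →L[ℝ] ℝ) (formCoord q η) q :=
  ((contMDiffAt_totalSpace.1 hη.contMDiffAt).2).mdifferentiableAt (by simp)

theorem fieldCoord_sum_smul {ι : Type*} (s : Finset ι) (q : Q) (a : ι → Q → ℝ)
    (W : ι → ∀ q : Q, TangentSpace 𝓘(ℝ, E) q) :
    ∀ᶠ x in 𝓝 q, fieldCoord q (fun x => ∑ i ∈ s, a i x • W i x) x =
      ∑ i ∈ s, a i x • fieldCoord q (W i) x := by
  filter_upwards [(trivializationAt E (TangentSpace 𝓘(ℝ, E) (M := Q)) q).open_baseSet.mem_nhds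
    (FiberBundle.mem_baseSet_trivializationAt' q)] with x hx
  have h2 : ∀ v, (trivializationAt E (TangentSpace 𝓘(ℝ, E) (M := Q)) q).continuousLinearMapAt
      ℝ x v = (trivializationAt E (TangentSpace 𝓘(ℝ, E) (M := Q)) q ⟨x, v⟩).2 := fun v => by
    rw [Bundle.Trivialization.continuousLinearMapAt_apply,
      Bundle.Trivialization.linearMapAt_apply, if_pos hx]
  simp only [fieldCoord, ← h2, map_sum, map_smul]

theorem formCoord_sum_smul {ι : Type*} (s : Finset ι) (q : Q) (a : ι → Q → ℝ)
    (η : ι → ∀ q : Q, TangentSpace 𝓘(ℝ, E) q →L[ℝ] ℝ) :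
    ∀ᶠ x in 𝓝 q, formCoord q (fun x => ∑ i ∈ s, a i x • η i x) x =
      ∑ i ∈ s, a i x • formCoord q (η i) x := by
  filter_upwards [(trivializationAt (E →L[ℝ] ℝ)
    (fun y : Q => TangentSpace 𝓘(ℝ, E) y →L[ℝ] ℝ) q).open_baseSet.mem_nhds
    (FiberBundle.mem_baseSet_trivializationAt' q)] with x hx
  have h2 : ∀ v, (trivializationAt (E →L[ℝ] ℝ)
      (fun y : Q => TangentSpace 𝓘(ℝ, E) y →L[ℝ] ℝ) q).continuousLinearMapAt
      ℝ x v = (trivializationAt (E →L[ℝ] ℝ)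
        (fun y : Q => TangentSpace 𝓘(ℝ, E) y →L[ℝ] ℝ) q ⟨x, v⟩).2 := fun v => by
    rw [Bundle.Trivialization.continuousLinearMapAt_apply,
      Bundle.Trivialization.linearMapAt_apply, if_pos hx]
  simp only [formCoord, ← h2, map_sum, map_smul]

theorem lieDeriv_eq {W : ∀ q : Q, TangentSpace 𝓘(ℝ, E) q}
    {η : ∀ q : Q, TangentSpace 𝓘(ℝ, E) q →L[ℝ] ℝ} {q : Q} {DW : E →L[ℝ] E}
    {Dη : E →L[ℝ] (E →L[ℝ] ℝ)} (hW : HasMFDerivAt 𝓘(ℝ, E) 𝓘(ℝ, E) (fieldCoord q W) q DW)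
    (hη : HasMFDerivAt 𝓘(ℝ, E) 𝓘(ℝ, E →L[ℝ] ℝ) (formCoord q η) q Dη) :
    lieDeriv W η q = Dη (W q) + ContinuousLinearMap.comp (η q) DW := by
  rw [← hW.mfderiv, ← hη.mfderiv]
  rfl

/-- The pointwise algebra behind `lieDeriv_sum_smul`: the left side is the coordinate formula for
the Lie derivative after the product rule has been applied to both sums. -/
theorem leibniz_sum_smul {ι κ : Type*} (s : Finset ι) (t : Finset κ) (a : ι → ℝ) (b : κ → ℝ)
    (W : ι → E) (η : κ → (E →L[ℝ] ℝ)) (da : ι → (E →L[ℝ] ℝ)) (db : κ → (E →L[ℝ] ℝ))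
    (DW : ι → (E →L[ℝ] E)) (Dη : κ → (E →L[ℝ] (E →L[ℝ] ℝ))) :
    (∑ j ∈ t, (b j • Dη j + (db j).smulRight (η j))) (∑ i ∈ s, a i • W i) +
      (∑ j ∈ t, b j • η j).comp (∑ i ∈ s, (a i • DW i + (da i).smulRight (W i))) =
    ∑ i ∈ s, ∑ j ∈ t, ((a i * b j) • (Dη j (W i) + (η j).comp (DW i)) +
      (a i * db j (W i)) • η j + (b j * η j (W i)) • da i) := by
  ext v
  simp only [_root_.sum_apply, _root_.add_apply, _root_.smul_apply, map_sum, map_add, map_smul,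
    ContinuousLinearMap.comp_apply, ContinuousLinearMap.smulRight_apply, Finset.smul_sum,
    smul_eq_mul]
  rw [← Finset.sum_add_distrib]
  refine Finset.sum_congr rfl fun i _ => ?_
  rw [Finset.mul_sum, Finset.mul_sum, ← Finset.sum_add_distrib, ← Finset.sum_add_distrib]
  refine Finset.sum_congr rfl fun j _ => ?_
  ring

theorem lieDeriv_sum_smul {ι κ : Type*} (s : Finset ι) (t : Finset κ)
    {a : ι → Q → ℝ} {b : κ → Q → ℝ}
    {W : ι → ∀ q : Q, TangentSpace 𝓘(ℝ, E) q}
    {η : κ → ∀ q : Q, TangentSpace 𝓘(ℝ, E) q →L[ℝ] ℝ}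
    (ha : ∀ i, ContMDiff 𝓘(ℝ, E) 𝓘(ℝ, ℝ) ∞ (a i)) (hb : ∀ j, ContMDiff 𝓘(ℝ, E) 𝓘(ℝ, ℝ) ∞ (b j))
    (hW : ∀ i, SmoothField (W i)) (hη : ∀ j, SmoothOneForm (η j)) (q : Q) :
    lieDeriv (fun x => ∑ i ∈ s, a i x • W i x) (fun x => ∑ j ∈ t, b j x • η j x) q =
      ∑ i ∈ s, ∑ j ∈ t, ((a i q * b j q) • lieDeriv (W i) (η j) q +
        (a i q * dBase (b j) q (W i q)) • η j q + (b j q * η j q (W i q)) • dBase (a i) q) := by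
  have hDW0 := fun i => ((hW i).mdifferentiableAt q).hasMFDerivAt
  have hDη0 := fun j => ((hη j).mdifferentiableAt q).hasMFDerivAt
  have hDW : HasMFDerivAt 𝓘(ℝ, E) 𝓘(ℝ, E) (fieldCoord q (fun x => ∑ i ∈ s, a i x • W i x)) q
      (∑ i ∈ s, (a i q • mfderiv 𝓘(ℝ, E) 𝓘(ℝ, E) (fieldCoord q (W i)) q +
        (dBase (a i) q).smulRight (W i q : E)) : TangentSpace 𝓘(ℝ, E) q →L[ℝ] E) := by
    refine HasMFDerivAt.congr_of_eventuallyEq (hasMFDerivAt_sum fun i hi => ?_)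
      (fieldCoord_sum_smul s q a W)
    have := hasMFDerivAt_smul
      ((ha i).mdifferentiableAt (by simp) : MDifferentiableAt _ _ _ q).hasMFDerivAt (hDW0 i)
    rwa [fieldCoord, tangent_trivialization_self] at this
  have hDη : HasMFDerivAt 𝓘(ℝ, E) 𝓘(ℝ, E →L[ℝ] ℝ)
      (formCoord q (fun x => ∑ j ∈ t, b j x • η j x)) q
      (∑ j ∈ t, (b j q • mfderiv 𝓘(ℝ, E) 𝓘(ℝ, E →L[ℝ] ℝ) (formCoord q (η j)) q +
        (dBase (b j) q).smulRight (η j q : E →L[ℝ] ℝ)) :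
        TangentSpace 𝓘(ℝ, E) q →L[ℝ] (E →L[ℝ] ℝ)) := by
    refine HasMFDerivAt.congr_of_eventuallyEq (hasMFDerivAt_sum fun i hi => ?_)
      (formCoord_sum_smul t q b η)
    have := hasMFDerivAt_smul
      ((hb i).mdifferentiableAt (by simp) : MDifferentiableAt _ _ _ q).hasMFDerivAt (hDη0 i)
    rwa [formCoord, cotangent_trivialization_self] at this
  have hL := fun i j => lieDeriv_eq (hDW0 i) (hDη0 j)
  refine (lieDeriv_eq hDW hDη).trans ?_
  simp only [hL]
  exact leibniz_sum_smul (E := E) s t (fun i => a i q) (fun j => b j q) (fun i => W i q)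
    (fun j => η j q) (fun i => dBase (a i) q) (fun j => dBase (b j) q) _ _

/-! ### Consequences of regularity: independent fields, invertible mass matrix -/

section Realization

variable {m : ℕ} {W : Fin m → ∀ q : Q, TangentSpace 𝓘(ℝ, E) q} {S : Set (CotangentBundle E Q)}

theorem SmoothField.hasMFDerivAt_momentum {Y : ∀ q : Q, TangentSpace 𝓘(ℝ, E) q}
    (hY : SmoothField Y) (z : CotangentBundle E Q) :
    HasMFDerivAt (cotangentModel E) 𝓘(ℝ, ℝ) (momentum Y) z
      (mfderiv (cotangentModel E) 𝓘(ℝ, ℝ) (momentum Y) z) :=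
  (hY.contMDiff_momentum.mdifferentiableAt (by simp)).hasMFDerivAt

theorem IsNaturalRealization.surjective_pi_dPhase (h : IsNaturalRealization W S)
    {z : CotangentBundle E Q} (hz : z ∈ S) :
    Function.Surjective (LinearMap.pi fun i => dPhase (momentum (W i)) z) := by
  have hs := h.regular z hz
  rw [(hasMFDerivAt_pi fun i => (h.smooth i).hasMFDerivAt_momentum z).mfderiv] at hs
  exact hs

theorem IsNaturalRealization.mem_iff (h : IsNaturalRealization W S) (z : CotangentBundle E Q) :
    z ∈ S ↔ ∀ i, z.2 (W i z.1) = 0 := by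
  rw [h.eq_zeros]; rfl

theorem IsNaturalRealization.zero_mem (h : IsNaturalRealization W S) (q : Q) :
    (⟨q, 0⟩ : CotangentBundle E Q) ∈ S := by
  rw [h.mem_iff]
  exact fun i => rfl

/-- The momenta are among the smooth functions vanishing on `S` that define `tangentTo`. -/
theorem IsNaturalRealization.dPhase_eq_zero (h : IsNaturalRealization W S)
    {z : CotangentBundle E Q} (i : Fin m) (X : tangentTo S z) :
    dPhase (momentum (W i)) z X = 0 := by
  have hX := X.2
  simp only [tangentTo, Submodule.mem_iInf] at hX
  exact hX (momentum (W i)) (h.smooth i).contMDiff_momentum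
    fun w hw => (h.mem_iff w).1 hw i

/-- On the zero section the differential of `P(Y)` depends linearly on the value of `Y`. -/
theorem exists_hasMFDerivAt_momentum_zero (q : Q) :
    ∃ L : E × (E →L[ℝ] ℝ) →L[ℝ] (E →L[ℝ] ℝ), ∀ Y : ∀ q : Q, TangentSpace 𝓘(ℝ, E) q,
      SmoothField Y → HasMFDerivAt (cotangentModel E) 𝓘(ℝ, ℝ) (momentum Y)
        (⟨q, 0⟩ : CotangentBundle E Q) (L.flip (Y q) : E × (E →L[ℝ] ℝ) →L[ℝ] ℝ) := by
  let z : CotangentBundle E Q := ⟨q, 0⟩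
  let P : CotangentBundle E Q → (E →L[ℝ] ℝ) := fun w => (trivializationAt (E →L[ℝ] ℝ)
    (fun y : Q => TangentSpace 𝓘(ℝ, E) y →L[ℝ] ℝ) q w).2
  have hP : MDifferentiableAt (cotangentModel E) 𝓘(ℝ, E →L[ℝ] ℝ) P z :=
    ((contMDiffAt_totalSpace (n := ∞) (f := fun w : CotangentBundle E Q => w)
      (x₀ := z)).1 contMDiffAt_id).2.mdifferentiableAt (by simp)
  refine ⟨mfderiv (cotangentModel E) 𝓘(ℝ, E →L[ℝ] ℝ) P z, fun Y hY => ?_⟩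
  have hYc := (hY.mdifferentiableAt q).hasMFDerivAt.comp z (hasMFDerivAt_proj z)
  have h := hasMFDerivAt_clm_apply hP.hasMFDerivAt hYc
  -- The derivative of `Y` enters the product rule only composed with `P z`, so it drops out on the
  -- zero section.
  have hP0 : P z = 0 := cotangent_trivialization_self q 0
  have hev : momentum Y =ᶠ[𝓝 z] fun w => P w (fieldCoord q Y w.1) := by
    have hc : ContinuousAt (fun w : CotangentBundle E Q => w.1) z := (hasMFDerivAt_proj z).1
    filter_upwards [hc ((chartAt E q).open_source.mem_nhds (mem_chart_source E q))] with w hw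
    exact (cotangent_trivialization_apply hw w.2 (Y w.1)).symm
  refine (h.congr_of_eventuallyEq hev).congr_mfderiv ?_
  simp only [Function.comp_apply]
  have hY0 : fieldCoord q Y z.1 = Y q := tangent_trivialization_self q (Y q)
  rw [hP0, hY0]
  exact (congrArg (· + _) (ContinuousLinearMap.zero_comp _)).trans (zero_add _)

/-- At the zero covector over `q`, which lies in `S`, a relation between the `W i q` would be a
relation between the `dP(W i)`, contradicting regularity. -/
theorem IsNaturalRealization.linearIndependent (h : IsNaturalRealization W S) (q : Q) :
    LinearIndependent ℝ (fun i => W i q) := by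
  rw [Fintype.linearIndependent_iff]
  intro c hc i
  obtain ⟨L, hL⟩ := exists_hasMFDerivAt_momentum_zero (E := E) q
  obtain ⟨ξ, hξ⟩ := h.surjective_pi_dPhase (h.zero_mem q) (Pi.single i 1)
  have h1 : ∀ j, L ξ (W j q) = (Pi.single i 1 : Fin m → ℝ) j := by
    intro j
    rw [← hξ, LinearMap.pi_apply, dPhase, (hL (W j) (h.smooth j)).mfderiv]
    rfl
  have h2 : L ξ (∑ j, c j • W j q : TangentSpace 𝓘(ℝ, E) q) = 0 := by
    rw [hc]; exact map_zero (L ξ)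
  have h3 : L ξ (∑ j, c j • W j q : TangentSpace 𝓘(ℝ, E) q) = ∑ j, c j * L ξ (W j q) := by
    exact (map_sum (L ξ) (fun j => c j • W j q) _).trans
      (Finset.sum_congr rfl fun j _ => (L ξ).map_smul _ _)
  rw [h3] at h2
  simpa [h1, Pi.single_apply] using h2

theorem massMatrix_apply (g : Metric E Q) (q : Q) (i j : Fin m) :
    massMatrix g W q i j = g.inner q (W i q) (W j q) := rfl

theorem inner_self_eq_zero (g : Metric E Q) {q : Q} {v : TangentSpace 𝓘(ℝ, E) q}
    (hv : g.inner q v v = 0) : v = 0 := by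
  by_contra hne
  exact (g.pos q v hne).ne' hv

/-- A Gram matrix of independent vectors: a kernel vector gives a combination of the `W i`
orthogonal to all of them, hence to itself. -/
theorem IsNaturalRealization.det_massMatrix_ne_zero (h : IsNaturalRealization W S)
    (g : Metric E Q) (q : Q) : (massMatrix g W q).det ≠ 0 := by
  intro hdet
  obtain ⟨v, hv0, hv⟩ := Matrix.exists_mulVec_eq_zero_iff.2 hdet
  refine hv0 (funext fun i => ?_)
  refine Fintype.linearIndependent_iff.1 (h.linearIndependent q) v (inner_self_eq_zero g ?_) i
  have h1 : ∀ i, g.inner q (W i q) (∑ j, v j • W j q) = 0 := by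
    intro i
    have := congrFun hv i
    simp only [Matrix.mulVec, dotProduct, massMatrix_apply, Pi.zero_apply] at this
    rw [map_sum, ← this]
    exact Finset.sum_congr rfl fun j _ => by rw [map_smul, smul_eq_mul, mul_comm]
  rw [map_sum]
  exact Finset.sum_eq_zero fun j _ => by rw [map_smul, g.symm, h1, smul_zero]

end Realization

/-! ### Smoothness of determinants and inverse matrices -/

section Smoothness

omit [IsManifold 𝓘(ℝ, E) ∞ Q] in
theorem contMDiff_det {m : ℕ} {A : Q → Matrix (Fin m) (Fin m) ℝ}
    (hA : ∀ i j, ContMDiff 𝓘(ℝ, E) 𝓘(ℝ, ℝ) ∞ (fun q => A q i j)) :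
    ContMDiff 𝓘(ℝ, E) 𝓘(ℝ, ℝ) ∞ (fun q => (A q).det) := by
  simp only [Matrix.det_apply']
  refine contMDiff_finsetSum fun σ _ => contMDiff_const.mul ?_
  exact contMDiff_finsetProd fun i _ => hA _ _

omit [IsManifold 𝓘(ℝ, E) ∞ Q] in
theorem contMDiff_inv_apply {m : ℕ} {A : Q → Matrix (Fin m) (Fin m) ℝ}
    (hA : ∀ i j, ContMDiff 𝓘(ℝ, E) 𝓘(ℝ, ℝ) ∞ (fun q => A q i j)) (hdet : ∀ q, (A q).det ≠ 0)
    (i j : Fin m) : ContMDiff 𝓘(ℝ, E) 𝓘(ℝ, ℝ) ∞ (fun q => (A q)⁻¹ i j) := by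
  -- Cramer's rule reduces an entry of the inverse to a quotient of determinants.
  have h1 : (fun q => (A q)⁻¹ i j) =
      fun q => ((A q).det)⁻¹ * ((A q).updateRow j (Pi.single i 1)).det := by
    ext q
    rw [Matrix.inv_def, Ring.inverse_eq_inv', Matrix.smul_apply, Matrix.adjugate_apply,
      smul_eq_mul]
  rw [h1]
  refine ((contMDiff_det hA).inv₀ hdet).mul (contMDiff_det fun k l => ?_)
  by_cases hk : k = j
  · subst hk
    simpa using contMDiff_const
  · simpa [Matrix.updateRow_apply, hk] using hA k l

end Smoothness

/-! ### The matrix `A` relating two realizations -/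

section FrameChange

/-- The matrix `(g(W'ⁱ, Wᵏ)) · (g(Wʲ, Wᵏ))⁻¹`, which expresses the fields `W'ⁱ` in terms of the
`Wʲ` when they span the same subspaces. -/
def frameMatrix (g : Metric E Q) {m m' : ℕ} (W : Fin m → ∀ q : Q, TangentSpace 𝓘(ℝ, E) q)
    (W' : Fin m' → ∀ q : Q, TangentSpace 𝓘(ℝ, E) q) (q : Q) : Matrix (Fin m') (Fin m) ℝ :=
  (Matrix.of fun i k => g.inner q (W' i q) (W k q)) * (massMatrix g W q)⁻¹

variable {m m' : ℕ} {W : Fin m → ∀ q : Q, TangentSpace 𝓘(ℝ, E) q}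
  {W' : Fin m' → ∀ q : Q, TangentSpace 𝓘(ℝ, E) q} {S : Set (CotangentBundle E Q)}

theorem contMDiff_frameMatrix (g : Metric E Q) (hW : IsNaturalRealization W S)
    (hW' : IsNaturalRealization W' S) (i : Fin m') (j : Fin m) :
    ContMDiff 𝓘(ℝ, E) 𝓘(ℝ, ℝ) ∞ (fun q => frameMatrix g W W' q i j) := by
  simp only [frameMatrix, Matrix.mul_apply, Matrix.of_apply]
  exact contMDiff_finsetSum fun k _ => (contMDiff_inner g (hW'.smooth i) (hW.smooth k)).mul
    (contMDiff_inv_apply (fun a b => contMDiff_inner g (hW.smooth a) (hW.smooth b))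
      (hW.det_massMatrix_ne_zero g) k j)

/-- `A` makes the remainder `r = W' i - ∑ A i j W j` orthogonal to every `W k`. Then `g(r, ·)` lies
in `S`, so it also kills `W' i`; hence `g(r, r) = 0`. -/
theorem sum_frameMatrix_smul (g : Metric E Q) (hW : IsNaturalRealization W S)
    (hW' : IsNaturalRealization W' S) (i : Fin m') (q : Q) :
    W' i q = ∑ j, frameMatrix g W W' q i j • W j q := by
  have hk : ∀ k, g.inner q (W' i q - ∑ j, frameMatrix g W W' q i j • W j q) (W k q) = 0 := by
    intro k
    have h1 : frameMatrix g W W' q * massMatrix g W q =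
        Matrix.of fun i k => g.inner q (W' i q) (W k q) := by
      rw [frameMatrix, Matrix.nonsing_inv_mul_cancel_right _ _
        (isUnit_iff_ne_zero.2 (hW.det_massMatrix_ne_zero g q))]
    have h2 := congrFun (congrFun h1 i) k
    simp only [Matrix.mul_apply, Matrix.of_apply, massMatrix_apply] at h2
    rw [g.symm, map_sub, g.symm q _ (W' i q), map_sum, ← h2, sub_eq_zero]
    exact Finset.sum_congr rfl fun j _ => by rw [map_smul, smul_eq_mul, g.symm]
  refine sub_eq_zero.1 (inner_self_eq_zero g ?_)
  have hmem := (hW.mem_iff ⟨q, g.inner q (W' i q - ∑ j, frameMatrix g W W' q i j • W j q)⟩).2 hk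
  have h' := (hW'.mem_iff _).1 hmem i
  rw [map_sub, map_sum, show g.inner q _ (W' i q) = 0 from h', zero_sub, neg_eq_zero]
  exact Finset.sum_eq_zero fun j _ => by rw [map_smul, hk, smul_zero]

/-- An independent family in the span of the `W i` at one point; without a point of `Q` the two
numbers are unrelated. -/
theorem IsNaturalRealization.card_le [Nonempty Q] (g : Metric E Q)
    (hW : IsNaturalRealization W S) (hW' : IsNaturalRealization W' S) : m' ≤ m := by
  obtain ⟨q⟩ := ‹Nonempty Q›
  have hle : Submodule.span ℝ (Set.range fun i => W' i q) ≤
      Submodule.span ℝ (Set.range fun i => W i q) := by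
    rw [Submodule.span_le]
    rintro _ ⟨i, rfl⟩
    change W' i q ∈ _
    rw [sum_frameMatrix_smul g hW hW' i q]
    exact Submodule.sum_mem _ fun j _ =>
      Submodule.smul_mem _ _ (Submodule.subset_span ⟨j, rfl⟩)
  have hfin : Module.Finite ℝ (Submodule.span ℝ (Set.range fun i => W i q)) :=
    FiniteDimensional.span_of_finite ℝ (Set.finite_range _)
  have h := Submodule.finrank_mono hle
  rwa [finrank_span_eq_card (hW'.linearIndependent q),
    finrank_span_eq_card (hW.linearIndependent q), Fintype.card_fin, Fintype.card_fin] at h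

theorem massMatrix_frameChange (g : Metric E Q) (hW : IsNaturalRealization W S)
    (hW' : IsNaturalRealization W' S) (q : Q) :
    massMatrix g W' q =
      frameMatrix g W W' q * massMatrix g W q * (frameMatrix g W W' q).transpose := by
  ext a b
  have h1 : frameMatrix g W W' q * massMatrix g W q =
      Matrix.of fun i k => g.inner q (W' i q) (W k q) := by
    rw [frameMatrix, Matrix.nonsing_inv_mul_cancel_right _ _
      (isUnit_iff_ne_zero.2 (hW.det_massMatrix_ne_zero g q))]
  rw [h1, massMatrix_apply]
  conv_lhs => rw [sum_frameMatrix_smul g hW hW' b q, map_sum]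
  simp only [Matrix.mul_apply, Matrix.of_apply, Matrix.transpose_apply]
  exact Finset.sum_congr rfl fun j _ => by rw [map_smul, smul_eq_mul, mul_comm]

end FrameChange

/-! ### Change of the nonholonomic volume -/

section SquareFrameChange

variable {m : ℕ} {W W' : Fin m → ∀ q : Q, TangentSpace 𝓘(ℝ, E) q} {S : Set (CotangentBundle E Q)}

theorem det_frameMatrix_ne_zero (g : Metric E Q) (hW : IsNaturalRealization W S)
    (hW' : IsNaturalRealization W' S) (q : Q) : (frameMatrix g W W' q).det ≠ 0 := by
  intro h
  apply hW'.det_massMatrix_ne_zero g q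
  rw [massMatrix_frameChange g hW hW' q, Matrix.det_mul, Matrix.det_mul, h, zero_mul, zero_mul]

omit [IsManifold 𝓘(ℝ, E) ∞ Q] [TopologicalSpace Q] [ChartedSpace E Q] in
theorem linearMap_sum_smul_apply {ι V : Type*} [Fintype ι] [AddCommGroup V] [Module ℝ V]
    (c : ι → ℝ) (f : ι → (V →ₗ[ℝ] ℝ)) (v : V) : (∑ j, c j • f j) v = ∑ j, c j * f j v := by
  simp

/-- By the product rule applied to `P(W') = A P(W)`: the terms containing `dA` carry a factor `P(W
j)`, which is zero on `S`. -/
theorem dPhase_momentum_frameChange (g : Metric E Q) (hW : IsNaturalRealization W S)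
    (hW' : IsNaturalRealization W' S) {z : CotangentBundle E Q} (hz : z ∈ S) (i : Fin m) :
    dPhase (momentum (W' i)) z = ∑ j, frameMatrix g W W' z.1 i j • dPhase (momentum (W j)) z := by
  have heq : momentum (W' i) =
      fun w => ∑ j, frameMatrix g W W' w.1 i j • momentum (W j) w := by
    ext w
    rw [momentum, sum_frameMatrix_smul g hW hW' i w.1, map_sum]
    exact Finset.sum_congr rfl fun j _ => by rw [map_smul]; rfl
  have hA := fun j => (((contMDiff_frameMatrix g hW hW' i j).comp
    (contMDiff_proj _ : ContMDiff (cotangentModel E) 𝓘(ℝ, E) ∞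
      fun w : CotangentBundle E Q => w.1)).mdifferentiableAt
      (x := z) (by simp)).hasMFDerivAt
  have h := hasMFDerivAt_sum (s := Finset.univ) fun j _ =>
    hasMFDerivAt_smul (hA j) ((hW.smooth j).hasMFDerivAt_momentum z)
  rw [dPhase]
  conv_lhs => rw [heq]
  refine LinearMap.ext fun ξ => ?_
  refine (DFunLike.congr_fun h.mfderiv ξ).trans ?_
  have hz' := (hW.mem_iff z).1 hz
  have h0 : ∀ j, momentum (W j) z = 0 := hz'
  refine Eq.trans ?_ (linearMap_sum_smul_apply (V := TangentAt z) _ _ ξ).symm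
  refine (_root_.sum_apply (F := E × (E →L[ℝ] ℝ) →L[ℝ] ℝ) _ _ ξ).trans ?_
  refine Finset.sum_congr rfl fun j _ => ?_
  rw [h0]
  change frameMatrix g W W' z.1 i j • dPhase (momentum (W j)) z ξ + (_ : ℝ) • (0 : ℝ) = _
  rw [smul_zero, add_zero, smul_eq_mul]

theorem sigmaForm_frameChange (g : Metric E Q) (hW : IsNaturalRealization W S)
    (hW' : IsNaturalRealization W' S) {z : CotangentBundle E Q} (hz : z ∈ S) :
    sigmaForm W' z = (frameMatrix g W W' z.1).det • sigmaForm W z := by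
  rw [sigmaForm, sigmaForm, ← wedgeCovectors_sum_smul]
  exact congrArg _ (funext fun i => dPhase_momentum_frameChange g hW hW' hz i)

/-- The pullback to `T_zS` of a form `ε` with `σ ∧ ε = ωⁿ` does not depend on `ε`. -/
theorem nhVolume_eq (hW : IsNaturalRealization W S) {k : ℕ}
    (hd : m + k = 2 * Module.finrank ℝ E) {z : CotangentBundle E Q} (hz : z ∈ S)
    {ε : TangentAt z [⋀^Fin k]→ₗ[ℝ] ℝ}
    (hε : (wedge (sigmaForm W z) ε).domDomCongr (finSumFinEquiv.trans (finCongr hd)) =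
        wedgePow (symplecticForm z) (Module.finrank ℝ E)) :
    nhVolume W S k z = ε.compLinearMap (tangentTo S z).subtype := by
  have hex : ∃ ε : TangentAt z [⋀^Fin k]→ₗ[ℝ] ℝ, ∃ hd : m + k = 2 * Module.finrank ℝ E,
      (wedge (sigmaForm W z) ε).domDomCongr (finSumFinEquiv.trans (finCongr hd)) =
        wedgePow (symplecticForm z) (Module.finrank ℝ E) := ⟨ε, hd, hε⟩
  rw [nhVolume, dif_pos hex]
  obtain ⟨_, hc⟩ := hex.choose_spec
  replace hc := hc.trans hε.symm
  have hw : wedge (sigmaForm W z) (hex.choose - ε) = 0 := by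
    have h1 : wedge (sigmaForm W z) hex.choose = wedge (sigmaForm W z) ε :=
      (AlternatingMap.domDomCongrEquiv (finSumFinEquiv.trans (finCongr hd))).injective hc
    rw [sub_eq_add_neg, ← neg_one_smul ℝ ε, wedge_add_right, wedge_smul_right, h1]
    module
  ext v
  -- Vectors of `tangentTo S z` lie in the common kernel of the `dP(W i)`, where the difference of
  -- two solutions vanishes.
  have h0 := apply_eq_zero_of_wedgeCovectors_wedge_eq_zero _ (hW.surjective_pi_dPhase hz) _ hw
    (fun j => (v j : TangentAt z)) (fun i j => hW.dPhase_eq_zero i (v j))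
  exact sub_eq_zero.1 h0

/-- Since `σ' = det A • σ`, a solution of `σ' ∧ ε = ωⁿ` yields the solution `det A • ε` of the
equation for `σ`; the determinant thus moves to the side of `W'`. -/
theorem nhVolume_frameChange (g : Metric E Q) (hW : IsNaturalRealization W S)
    (hW' : IsNaturalRealization W' S) {k : ℕ} (hd : m + k = 2 * Module.finrank ℝ E)
    {z : CotangentBundle E Q} (hz : z ∈ S) :
    nhVolume W S k z = (frameMatrix g W W' z.1).det • nhVolume W' S k z := by
  have hdet := det_frameMatrix_ne_zero g hW hW' z.1
  have hσ := sigmaForm_frameChange g hW hW' hz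
  by_cases hex : ∃ ε : TangentAt z [⋀^Fin k]→ₗ[ℝ] ℝ, ∃ hd : m + k = 2 * Module.finrank ℝ E,
      (wedge (sigmaForm W' z) ε).domDomCongr (finSumFinEquiv.trans (finCongr hd)) =
        wedgePow (symplecticForm z) (Module.finrank ℝ E)
  · obtain ⟨ε, _, hε⟩ := hex
    rw [nhVolume_eq hW' hd hz hε]
    rw [hσ, wedge_smul_left, ← wedge_smul_right] at hε
    rw [nhVolume_eq hW hd hz hε]
    rfl
  -- The two equations are solvable together, so no existence result is needed: otherwise both
  -- volumes take the default value `0`.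
  · have hex' : ¬ ∃ ε : TangentAt z [⋀^Fin k]→ₗ[ℝ] ℝ, ∃ hd : m + k = 2 * Module.finrank ℝ E,
        (wedge (sigmaForm W z) ε).domDomCongr (finSumFinEquiv.trans (finCongr hd)) =
          wedgePow (symplecticForm z) (Module.finrank ℝ E) := by
      rintro ⟨ε, _, hε⟩
      refine hex ⟨(frameMatrix g W W' z.1).det⁻¹ • ε, hd, ?_⟩
      rw [hσ, wedge_smul_left, wedge_smul_right, smul_smul, mul_inv_cancel₀ hdet, one_smul, hε]
    rw [nhVolume, dif_neg hex', nhVolume, dif_neg hex, smul_zero]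

end SquareFrameChange

/-! ### Change of the density form -/

section DensityForm

variable {m : ℕ} {W W' : Fin m → ∀ q : Q, TangentSpace 𝓘(ℝ, E) q} {S : Set (CotangentBundle E Q)}

/-- The section of `𝒟⁰` by which the density forms of two natural realizations differ, up to an
exact form. -/
def densityShift (g : Metric E Q) (W W' : Fin m → ∀ q : Q, TangentSpace 𝓘(ℝ, E) q) (q : Q) :
    TangentSpace 𝓘(ℝ, E) q →L[ℝ] ℝ :=
  ∑ j, (∑ a, ∑ b, ∑ i, (massMatrix g W' q)⁻¹ a b * (frameMatrix g W W' q a i *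
    dBase (fun x => frameMatrix g W W' x b j) q (W i q))) • flatForm g (W j) q

/-- It is a smooth combination of the forms `g(W j, ·)`, and `v ∈ 𝒟` means that `g(v, ·)` kills
every `W j`. -/
theorem isAnnihilatorSection_densityShift (g : Metric E Q) (hW : IsNaturalRealization W S)
    (hW' : IsNaturalRealization W' S) : IsAnnihilatorSection g S (densityShift g W W') := by
  constructor
  · refine SmoothOneForm.sum_smul (fun j _ => ?_) fun j _ => (hW.smooth j).smoothOneForm_flatForm g
    refine contMDiff_finsetSum fun a _ => contMDiff_finsetSum fun b _ =>
      contMDiff_finsetSum fun i _ => ?_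
    refine (contMDiff_inv_apply (fun c d => contMDiff_inner g (hW'.smooth c) (hW'.smooth d))
      (hW'.det_massMatrix_ne_zero g) a b).mul ?_
    exact (contMDiff_frameMatrix g hW hW' a i).mul
      (contMDiff_dBase_apply (contMDiff_frameMatrix g hW hW' b j) (hW.smooth i))
  · intro q v hv
    rw [densityShift, _root_.sum_apply]
    refine Finset.sum_eq_zero fun j _ => ?_
    rw [_root_.smul_apply, flatForm, g.symm, show g.inner q v (W j q) = 0 from
      (hW.mem_iff _).1 hv j, smul_zero]

/-- The primitive `log |det A|` of the exact part of the difference of the density forms of two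
natural realizations related by `W' = A W`. -/
def logDetFrame (g : Metric E Q) (W W' : Fin m → ∀ q : Q, TangentSpace 𝓘(ℝ, E) q) (q : Q) : ℝ :=
  Real.log (frameMatrix g W W' q).det

theorem contMDiff_logDetFrame (g : Metric E Q) (hW : IsNaturalRealization W S)
    (hW' : IsNaturalRealization W' S) : ContMDiff 𝓘(ℝ, E) 𝓘(ℝ, ℝ) ∞ (logDetFrame g W W') := by
  intro q
  exact (Real.contDiffAt_log.2 (det_frameMatrix_ne_zero g hW hW' q)).contMDiffAt.comp q
    (contMDiff_det (contMDiff_frameMatrix g hW hW') q)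

/-- Jacobi's formula divided by `det A`, with `A⁻¹ = (det A)⁻¹ adj A`. -/
theorem dBase_logDetFrame (g : Metric E Q) (hW : IsNaturalRealization W S)
    (hW' : IsNaturalRealization W' S) (q : Q) :
    dBase (E := E) (logDetFrame g W W') q = ∑ a, ∑ i, (frameMatrix g W W' q)⁻¹ i a •
      dBase (E := E) (fun x => frameMatrix g W W' x a i) q := by
  have hA : ∀ a i, HasMFDerivAt 𝓘(ℝ, E) 𝓘(ℝ, ℝ) (fun x => frameMatrix g W W' x a i) q
      (dBase (fun x => frameMatrix g W W' x a i) q) := fun a i =>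
    ((contMDiff_frameMatrix g hW hW' a i).mdifferentiableAt (by simp)).hasMFDerivAt
  have h := HasMFDerivAt.comp q (I' := 𝓘(ℝ, ℝ)) (Real.hasDerivAt_log
    (det_frameMatrix_ne_zero g hW hW' q)).hasFDerivAt.hasMFDerivAt (hasMFDerivAt_det hA)
  refine h.mfderiv.trans (ContinuousLinearMap.ext fun v => ?_)
  have e1 : (∑ a, ∑ i, (frameMatrix g W W' q)⁻¹ i a •
      dBase (fun x => frameMatrix g W W' x a i) q) v = ∑ a, ∑ i, (frameMatrix g W W' q)⁻¹ i a *
      dBase (fun x => frameMatrix g W W' x a i) q v := by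
    simp only [_root_.sum_apply, _root_.smul_apply, smul_eq_mul]
  have e2 : (∑ a, ∑ i, (frameMatrix g W W' q).adjugate i a •
      dBase (fun x => frameMatrix g W W' x a i) q) v =
      ∑ a, ∑ i, (frameMatrix g W W' q).adjugate i a *
      dBase (fun x => frameMatrix g W W' x a i) q v := by
    simp only [_root_.sum_apply, _root_.smul_apply, smul_eq_mul]
  refine Eq.trans ?_ e1.symm
  refine (congrArg (fun r : ℝ => r * (frameMatrix g W W' q).det⁻¹) e2).trans ?_
  rw [Finset.sum_mul]
  refine Finset.sum_congr rfl fun a _ => ?_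
  rw [Finset.sum_mul]
  refine Finset.sum_congr rfl fun i _ => ?_
  rw [Matrix.inv_def, Ring.inverse_eq_inv', Matrix.smul_apply, smul_eq_mul]
  ring

-- Reordering of finite sums. For `N = M'⁻¹` the three groups on the right become `ϑ`, `tr(A⁻¹ dA)`
-- and the section of `𝒟⁰`.
omit [IsManifold 𝓘(ℝ, E) ∞ Q] [TopologicalSpace Q] [ChartedSpace E Q] in
theorem sum_frame_expansion {V ι : Type*} [AddCommGroup V] [Module ℝ V] [Fintype ι]
    (N A M : Matrix ι ι ℝ) (w : ι → ι → ι → ℝ) (l dA : ι → ι → V) (η : ι → V) :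
    ∑ a, ∑ b, N a b • ∑ i, ∑ j, ((A a i * A b j) • l i j + (A a i * w b j i) • η j +
      (A b j * M j i) • dA a i) =
    ∑ i, ∑ j, (A.transpose * N * A) i j • l i j + ∑ a, ∑ i, (N * A * M) a i • dA a i +
      ∑ j, (∑ a, ∑ b, ∑ i, N a b * (A a i * w b j i)) • η j := by
  simp only [Matrix.mul_apply, Matrix.transpose_apply, Finset.smul_sum, Finset.sum_smul, smul_smul,
    Finset.sum_mul, smul_add, Finset.sum_add_distrib]
  rw [add_right_comm]
  refine congrArg₂ (· + ·) (congrArg₂ (· + ·) ?_ ?_) ?_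
  · refine ((Finset.sum_congr rfl fun a _ => Finset.sum_comm).trans (Finset.sum_comm.trans
      (Finset.sum_congr rfl fun i _ => (Finset.sum_congr rfl fun a _ => Finset.sum_comm).trans
      (Finset.sum_comm.trans (Finset.sum_congr rfl fun j _ => Finset.sum_comm))))).trans ?_
    refine Finset.sum_congr rfl fun i _ => Finset.sum_congr rfl fun j _ =>
      Finset.sum_congr rfl fun b _ => Finset.sum_congr rfl fun a _ => ?_
    congr 1
    ring
  · refine Finset.sum_congr rfl fun a _ => (Finset.sum_comm.trans
      (Finset.sum_congr rfl fun i _ => Finset.sum_comm)).trans ?_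
    refine Finset.sum_congr rfl fun i _ => Finset.sum_congr rfl fun j _ =>
      Finset.sum_congr rfl fun b _ => ?_
    congr 1
    ring
  · exact (Finset.sum_congr rfl fun a _ => (Finset.sum_congr rfl fun b _ =>
      Finset.sum_comm).trans Finset.sum_comm).trans Finset.sum_comm

-- These products are the coefficients of the Lie derivatives and of `dA` in the expansion of the
-- new density form; both follow from `M'⁻¹ = (Aᵀ)⁻¹ M⁻¹ A⁻¹`.
omit [IsManifold 𝓘(ℝ, E) ∞ Q] [TopologicalSpace Q] [ChartedSpace E Q] in
theorem congruence_inv_identities {ι : Type*} [Fintype ι] [DecidableEq ι] {M M' A : Matrix ι ι ℝ}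
    (h : M' = A * M * A.transpose) (hM : M.det ≠ 0) (hA : A.det ≠ 0) :
    A.transpose * M'⁻¹ * A = M⁻¹ ∧ M'⁻¹ * A * M = (A⁻¹).transpose := by
  have hAu := isUnit_iff_ne_zero.2 hA
  have hMu := isUnit_iff_ne_zero.2 hM
  have hTu : IsUnit A.transpose.det := by rwa [Matrix.det_transpose]
  have h1 : M'⁻¹ = (A.transpose)⁻¹ * M⁻¹ * A⁻¹ := by
    rw [h, Matrix.mul_inv_rev, Matrix.mul_inv_rev, Matrix.mul_assoc]
  constructor
  · rw [h1, Matrix.mul_assoc, Matrix.nonsing_inv_mul_cancel_right _ _ hAu, ← Matrix.mul_assoc,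
      Matrix.mul_nonsing_inv _ hTu, Matrix.one_mul]
  · rw [h1, Matrix.nonsing_inv_mul_cancel_right _ _ hAu,
      Matrix.nonsing_inv_mul_cancel_right _ _ hMu, Matrix.transpose_nonsing_inv]

/-- The density forms of two natural realizations with `W' = A W` differ by `d log |det A|` and a
section of `𝒟⁰`. -/
theorem densityForm_frameChange (g : Metric E Q) (hW : IsNaturalRealization W S)
    (hW' : IsNaturalRealization W' S) (q : Q) :
    densityForm g W' q = densityForm g W q + dBase (logDetFrame g W W') q +
      densityShift g W W' q := by
  obtain ⟨h1, h2⟩ := congruence_inv_identities (massMatrix_frameChange g hW hW' q)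
    (hW.det_massMatrix_ne_zero g q) (det_frameMatrix_ne_zero g hW hW' q)
  have hlie : ∀ a b, lieDeriv (W' a) (flatForm g (W' b)) q =
      ∑ i, ∑ j, ((frameMatrix g W W' q a i * frameMatrix g W W' q b j) •
        lieDeriv (W i) (flatForm g (W j)) q +
        (frameMatrix g W W' q a i * dBase (fun x => frameMatrix g W W' x b j) q (W i q)) •
          flatForm g (W j) q +
        (frameMatrix g W W' q b j * massMatrix g W q j i) •
          dBase (fun x => frameMatrix g W W' x a i) q) := by
    intro a b
    have hWa : W' a = fun x => ∑ i, frameMatrix g W W' x a i • W i x :=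
      funext fun x => sum_frameMatrix_smul g hW hW' a x
    have hηb : flatForm g (W' b) = fun x => ∑ j, frameMatrix g W W' x b j • flatForm g (W j) x := by
      funext x
      rw [flatForm, sum_frameMatrix_smul g hW hW' b x, map_sum]
      exact Finset.sum_congr rfl fun j _ => map_smul _ _ _
    refine (congrArg₂ (fun X θ => lieDeriv X θ q) hWa hηb).trans ?_
    exact lieDeriv_sum_smul _ _ (contMDiff_frameMatrix g hW hW' a)
      (contMDiff_frameMatrix g hW hW' b) hW.smooth
      (fun j => (hW.smooth j).smoothOneForm_flatForm g) q
  rw [densityForm]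
  simp only [hlie]
  refine (sum_frame_expansion (massMatrix g W' q)⁻¹ (frameMatrix g W W' q) (massMatrix g W q)
    (fun b j i => dBase (fun x => frameMatrix g W W' x b j) q (W i q))
    (fun i j => lieDeriv (W i) (flatForm g (W j)) q)
    (fun a i => dBase (fun x => frameMatrix g W W' x a i) q) fun j => flatForm g (W j) q).trans ?_
  rw [h1, h2, dBase_logDetFrame g hW hW' q]
  rfl

end DensityForm

/-! ### The Hamiltonian and the velocity of the nonholonomic motion -/

section Hamiltonian

/-- The metric at `x` in the coordinates of the preferred chart at `q`. -/
abbrev metricCoord (g : Metric E Q) (q x : Q) : E →L[ℝ] (E →L[ℝ] ℝ) :=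
  ContinuousLinearMap.inCoordinates E (TangentSpace 𝓘(ℝ, E) (M := Q)) (E →L[ℝ] ℝ)
    (fun y : Q => TangentSpace 𝓘(ℝ, E) y →L[ℝ] ℝ) q x q x (g.inner x)

theorem metricCoord_apply (g : Metric E Q) {q x : Q} (hx : x ∈ (chartAt E q).source)
    (v : TangentSpace 𝓘(ℝ, E) x) :
    metricCoord g q x (trivializationAt E (TangentSpace 𝓘(ℝ, E) (M := Q)) q ⟨x, v⟩).2 =
      (trivializationAt (E →L[ℝ] ℝ) (fun y : Q => TangentSpace 𝓘(ℝ, E) y →L[ℝ] ℝ) q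
        ⟨x, g.inner x v⟩).2 := by
  have hx' : x ∈ (trivializationAt E (TangentSpace 𝓘(ℝ, E) (M := Q)) q).baseSet := hx
  have hx2 : x ∈ (trivializationAt (E →L[ℝ] ℝ)
      (fun y : Q => TangentSpace 𝓘(ℝ, E) y →L[ℝ] ℝ) q).baseSet := by
    rw [hom_trivializationAt_baseSet]
    exact ⟨hx, Set.mem_univ _⟩
  have e : ((trivializationAt E (TangentSpace 𝓘(ℝ, E) (M := Q)) q).continuousLinearEquivAt
      ℝ x hx').symm (trivializationAt E (TangentSpace 𝓘(ℝ, E) (M := Q)) q ⟨x, v⟩).2 = v := by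
    rw [ContinuousLinearEquiv.symm_apply_eq]
    rfl
  have h := ContinuousLinearMap.inCoordinates_eq (σ := RingHom.id ℝ) (F := E) (F' := E →L[ℝ] ℝ)
    (E := TangentSpace 𝓘(ℝ, E) (M := Q)) (E' := fun y : Q => TangentSpace 𝓘(ℝ, E) y →L[ℝ] ℝ)
    (ϕ := g.inner x) hx' hx2
  refine (congrArg (fun L : E →L[ℝ] (E →L[ℝ] ℝ) =>
    L (trivializationAt E (TangentSpace 𝓘(ℝ, E) (M := Q)) q ⟨x, v⟩).2) h).trans ?_
  simp only [ContinuousLinearMap.comp_apply]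
  erw [e]
  rfl

theorem mdifferentiableAt_metricCoord (g : Metric E Q) (q : Q) :
    MDifferentiableAt 𝓘(ℝ, E) 𝓘(ℝ, E →L[ℝ] (E →L[ℝ] ℝ)) (metricCoord g q) q :=
  ((contMDiffAt_hom_bundle _).1 g.contMDiff.contMDiffAt).2.mdifferentiableAt (by simp)

theorem mdifferentiableAt_momentumCoord (z : CotangentBundle E Q) :
    MDifferentiableAt (cotangentModel E) 𝓘(ℝ, E →L[ℝ] ℝ) (fun w : CotangentBundle E Q =>
      (trivializationAt (E →L[ℝ] ℝ) (fun y : Q => TangentSpace 𝓘(ℝ, E) y →L[ℝ] ℝ) z.1 w).2) z :=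
  ((contMDiffAt_totalSpace (n := ∞) (f := fun w : CotangentBundle E Q => w)
    (x₀ := z)).1 contMDiffAt_id).2.mdifferentiableAt (by simp)

variable [FiniteDimensional ℝ E]

theorem inner_fiberDeriv_symm (g : Metric E Q) (q : Q) (p : TangentSpace 𝓘(ℝ, E) q →L[ℝ] ℝ) :
    g.inner q ((fiberDeriv g q).symm p) = p :=
  (fiberDeriv g q).apply_symm_apply p

theorem hamiltonian_eq (g : Metric E Q) (V : Q → ℝ) (z : CotangentBundle E Q) :
    hamiltonian g V z = (1 / 2) * z.2 ((fiberDeriv g z.1).symm z.2) + V z.1 := by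
  rw [hamiltonian, lagrangian, inner_fiberDeriv_symm]
  ring

/-- The musical isomorphism `v ↦ g(v, ·)` at a point, as a continuous linear equivalence of the
model spaces. -/
def flatEquiv (g : Metric E Q) (q : Q) : E ≃L[ℝ] (E →L[ℝ] ℝ) :=
  LinearEquiv.toContinuousLinearEquiv (E := E) (F := E →L[ℝ] ℝ) (fiberDeriv g q)

theorem metricCoord_self (g : Metric E Q) (q : Q) : metricCoord g q q = flatEquiv g q := by
  refine ContinuousLinearMap.ext fun v => ?_
  have h := metricCoord_apply g (mem_chart_source E q) v
  exact (congrArg _ (tangent_trivialization_self q v)).symm.trans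
    (h.trans (cotangent_trivialization_self q _))

omit [IsManifold 𝓘(ℝ, E) ∞ Q] [FiniteDimensional ℝ E] in
theorem mdifferentiableAt_clm_inverse {F G : Type*} [NormedAddCommGroup F] [NormedSpace ℝ F]
    [CompleteSpace F] [NormedAddCommGroup G] [NormedSpace ℝ G] {B : Q → (F →L[ℝ] G)} {q : Q}
    {e : F ≃L[ℝ] G} (hB : MDifferentiableAt 𝓘(ℝ, E) 𝓘(ℝ, F →L[ℝ] G) B q) (he : B q = e) :
    MDifferentiableAt 𝓘(ℝ, E) 𝓘(ℝ, G →L[ℝ] F) (fun x => (B x).inverse) q := by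
  have hinv : DifferentiableAt ℝ (fun C : F →L[ℝ] G => (C.inverse : G →L[ℝ] F)) (B q) := by
    rw [he]
    exact (contDiffAt_map_inverse (n := 1) e).differentiableAt (by simp)
  exact hinv.mdifferentiableAt.comp q hB

/-- In coordinates `H = ½ p(G⁻¹p) + V`, and operator inversion is differentiable at invertible
operators. Differentiability ensures that `dPhase` is the true derivative and not the default `0`.
-/
theorem mdifferentiableAt_hamiltonian (g : Metric E Q) {V : Q → ℝ}
    (hV : ContMDiff 𝓘(ℝ, E) 𝓘(ℝ, ℝ) ∞ V) (z : CotangentBundle E Q) :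
    MDifferentiableAt (cotangentModel E) 𝓘(ℝ, ℝ) (hamiltonian g V) z := by
  have : CompleteSpace E := FiniteDimensional.complete ℝ E
  have hproj : MDifferentiableAt (cotangentModel E) 𝓘(ℝ, E)
      (fun w : CotangentBundle E Q => w.1) z := (hasMFDerivAt_proj z).mdifferentiableAt
  have hG : MDifferentiableAt (cotangentModel E) 𝓘(ℝ, (E →L[ℝ] ℝ) →L[ℝ] E)
      (fun w : CotangentBundle E Q => (metricCoord g z.1 w.1).inverse) z :=
    MDifferentiableAt.comp z (g := fun x => (metricCoord g z.1 x).inverse)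
      (mdifferentiableAt_clm_inverse (mdifferentiableAt_metricCoord g z.1)
        (metricCoord_self g z.1)) hproj
  have hP := mdifferentiableAt_momentumCoord z
  have hH : MDifferentiableAt (cotangentModel E) 𝓘(ℝ, ℝ) (fun w : CotangentBundle E Q =>
      (1 / 2 : ℝ) * ((trivializationAt (E →L[ℝ] ℝ)
        (fun y : Q => TangentSpace 𝓘(ℝ, E) y →L[ℝ] ℝ) z.1 w).2
        ((metricCoord g z.1 w.1).inverse (trivializationAt (E →L[ℝ] ℝ)
        (fun y : Q => TangentSpace 𝓘(ℝ, E) y →L[ℝ] ℝ) z.1 w).2)) + V w.1) z :=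
    (MDifferentiableAt.mul mdifferentiableAt_const (hP.clm_apply (hG.clm_apply hP))).add
      (MDifferentiableAt.comp z (hV.mdifferentiableAt (by simp)) hproj)
  refine hH.congr_of_eventuallyEq ?_
  -- Invertible operators form an open set, so near `z.1` the total function `inverse` is the actual
  -- inverse of the metric.
  have hnhds : ∀ᶠ x in 𝓝 z.1, metricCoord g z.1 x ∈
      Set.range ((↑) : (E ≃L[ℝ] (E →L[ℝ] ℝ)) → (E →L[ℝ] (E →L[ℝ] ℝ))) :=
    (mdifferentiableAt_metricCoord g z.1).continuousAt.eventually_mem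
      (by rw [metricCoord_self]; exact ContinuousLinearEquiv.nhds _)
  filter_upwards [hproj.continuousAt.eventually hnhds, hproj.continuousAt.eventually
    ((chartAt E z.1).open_source.mem_nhds (mem_chart_source E z.1))] with w hw hws
  obtain ⟨e, he⟩ := hw
  have h1 := metricCoord_apply g hws ((fiberDeriv g w.1).symm w.2)
  rw [inner_fiberDeriv_symm] at h1
  have h2 : (metricCoord g z.1 w.1).inverse (trivializationAt (E →L[ℝ] ℝ)
      (fun y : Q => TangentSpace 𝓘(ℝ, E) y →L[ℝ] ℝ) z.1 w).2 =
      (trivializationAt E (TangentSpace 𝓘(ℝ, E) (M := Q)) z.1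
        ⟨w.1, (fiberDeriv g w.1).symm w.2⟩).2 := by
    rw [← he, ContinuousLinearMap.inverse_equiv]
    refine e.symm_apply_eq.2 ?_
    rw [← he] at h1
    exact h1.symm
  rw [hamiltonian_eq, h2]
  congr 2
  exact (cotangent_trivialization_apply hws w.2 _).symm

/-- On a fibre `H` is quadratic plus a constant; the symmetry of `g` merges the two halves of its
derivative into `∂H/∂p`, the velocity. -/
theorem dPhase_hamiltonian_vertical (g : Metric E Q) {V : Q → ℝ}
    (hV : ContMDiff 𝓘(ℝ, E) 𝓘(ℝ, ℝ) ∞ V) (z : CotangentBundle E Q) (δ : E →L[ℝ] ℝ) :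
    dPhase (hamiltonian g V) z ((0, δ) : E × (E →L[ℝ] ℝ)) =
      δ ((fiberDeriv g z.1).symm z.2 : TangentSpace 𝓘(ℝ, E) z.1) := by
  let Λ : (E →L[ℝ] ℝ) →L[ℝ] E := (flatEquiv g z.1).symm
  let p₀ : E →L[ℝ] ℝ := z.2
  have h1 := HasMFDerivAt.comp (I := 𝓘(ℝ, E →L[ℝ] ℝ)) (M := E →L[ℝ] ℝ) p₀
    (mdifferentiableAt_hamiltonian g hV z).hasMFDerivAt (hasMFDerivAt_fiber z)
  have h2 : HasFDerivAt (fun p : E →L[ℝ] ℝ => (1 / 2 : ℝ) * p (Λ p) + V z.1)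
      ((1 / 2 : ℝ) • (p₀.comp Λ + (ContinuousLinearMap.id ℝ (E →L[ℝ] ℝ)).flip (Λ p₀))) p₀ :=
    (((hasFDerivAt_id p₀).clm_apply Λ.hasFDerivAt).const_mul (1 / 2 : ℝ)).add_const _
  have hfun : (fun p : E →L[ℝ] ℝ => (1 / 2 : ℝ) * p (Λ p) + V z.1) =
      hamiltonian g V ∘ fun p : E →L[ℝ] ℝ => (⟨z.1, p⟩ : CotangentBundle E Q) :=
    funext fun p => (hamiltonian_eq g V ⟨z.1, p⟩).symm
  have h3 := h2.hasMFDerivAt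
  rw [hfun] at h3
  have h4 := DFunLike.congr_fun (hasMFDerivAt_unique h1 h3) δ
  have hsym : p₀ (Λ δ) = δ (Λ p₀) := by
    have e1 : ∀ p, g.inner z.1 (Λ p) = p := fun p => inner_fiberDeriv_symm g z.1 p
    exact (DFunLike.congr_fun (e1 p₀) (Λ δ : E)).symm.trans
      ((g.symm _ _ _).trans (DFunLike.congr_fun (e1 δ) (Λ p₀ : E)))
  have h5 : (1 / 2 : ℝ) * (p₀ (Λ δ) + δ (Λ p₀)) = δ (Λ p₀) := by rw [hsym]; ring
  exact h4.trans h5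

/-- Test the equation of motion on vertical vectors `(0, δ)`: the constraint force is pulled back
from `Q` and vanishes, leaving Hamilton's equation for the velocity. -/
theorem IsNonholonomicVector.qPart_eq {g : Metric E Q} {V : Q → ℝ}
    (hV : ContMDiff 𝓘(ℝ, E) 𝓘(ℝ, ℝ) ∞ V) {S : Set (CotangentBundle E Q)}
    {z : CotangentBundle E Q} {X : TangentAt z} (hX : IsNonholonomicVector g V S z X) :
    qPart z X = (fiberDeriv g z.1).symm z.2 := by
  obtain ⟨_, ρ, _, h⟩ := hX
  have key : ∀ δ : E →L[ℝ] ℝ, δ (qPart z X) =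
      δ ((fiberDeriv g z.1).symm z.2 : TangentSpace 𝓘(ℝ, E) z.1) := by
    intro δ
    have h1 := h ((0, δ) : E × (E →L[ℝ] ℝ))
    rw [dPhase_hamiltonian_vertical g hV] at h1
    have h2 : dProj z ((0, δ) : E × (E →L[ℝ] ℝ)) = 0 := dProj_apply z _
    have h3 : symplecticBilin z X ((0, δ) : E × (E →L[ℝ] ℝ)) =
        δ (qPart z X) - pPart z X (0 : E) := rfl
    rw [h2, map_zero, add_zero, h3, map_zero, sub_zero] at h1
    exact h1
  exact (SeparatingDual.eq_iff_forall_dual_eq (R := ℝ) (V := E)).2 key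

/-- A function on `Q` whose differential annihilates the distribution is a constant of motion. -/
theorem isConstantOfMotion_comp_proj {g : Metric E Q} {V : Q → ℝ}
    (hV : ContMDiff 𝓘(ℝ, E) 𝓘(ℝ, ℝ) ∞ V) {S : Set (CotangentBundle E Q)} {F : Q → ℝ}
    (hF : ContMDiff 𝓘(ℝ, E) 𝓘(ℝ, ℝ) ∞ F)
    (hann : ∀ q, ∀ v ∈ distribution g S q, dBase F q v = 0) :
    IsConstantOfMotion g V S (fun z => F z.1) := by
  intro z hz X hX
  have h := HasMFDerivAt.comp z (hF.mdifferentiableAt (x := z.1) (by simp)).hasMFDerivAt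
    (hasMFDerivAt_proj z)
  have h1 : dPhase (fun z : CotangentBundle E Q => F z.1) z X = dBase F z.1 (qPart z X) :=
    DFunLike.congr_fun h.mfderiv X
  rw [h1, hX.qPart_eq hV]
  refine hann _ _ ?_
  change (⟨z.1, g.inner z.1 ((fiberDeriv g z.1).symm z.2)⟩ : CotangentBundle E Q) ∈ S
  rw [inner_fiberDeriv_symm]
  exact hz

end Hamiltonian

/-! ### Transfer of exactness and comparison of the weighted volumes -/

section Exactness

variable {m : ℕ} {W W' : Fin m → ∀ q : Q, TangentSpace 𝓘(ℝ, E) q} {S : Set (CotangentBundle E Q)}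

theorem IsAnnihilatorSection.sub {g : Metric E Q}
    {ρ ρ' : ∀ q : Q, TangentSpace 𝓘(ℝ, E) q →L[ℝ] ℝ} (hρ : IsAnnihilatorSection g S ρ)
    (hρ' : IsAnnihilatorSection g S ρ') : IsAnnihilatorSection g S (fun q => ρ q - ρ' q) := by
  refine ⟨ContMDiff.sub_section hρ.1 hρ'.1, fun q v hv => ?_⟩
  rw [_root_.sub_apply, hρ.2 q v hv, hρ'.2 q v hv, sub_zero]

omit [IsManifold 𝓘(ℝ, E) ∞ Q] in
theorem dBase_add {f h : Q → ℝ} (hf : ContMDiff 𝓘(ℝ, E) 𝓘(ℝ, ℝ) ∞ f)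
    (hh : ContMDiff 𝓘(ℝ, E) 𝓘(ℝ, ℝ) ∞ h) (q : Q) :
    dBase (E := E) (fun x => f x + h x) q = dBase f q + dBase h q :=
  ((hf.mdifferentiableAt (by simp)).hasMFDerivAt.add
    (hh.mdifferentiableAt (by simp)).hasMFDerivAt).mfderiv

omit [IsManifold 𝓘(ℝ, E) ∞ Q] in
theorem dBase_sub {f h : Q → ℝ} (hf : ContMDiff 𝓘(ℝ, E) 𝓘(ℝ, ℝ) ∞ f)
    (hh : ContMDiff 𝓘(ℝ, E) 𝓘(ℝ, ℝ) ∞ h) (q : Q) :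
    dBase (E := E) (fun x => f x - h x) q = dBase f q - dBase h q :=
  ((hf.mdifferentiableAt (by simp)).hasMFDerivAt.sub
    (hh.mdifferentiableAt (by simp)).hasMFDerivAt).mfderiv

/-- If `ϑ_𝒞 + ρ = df`, then `ϑ_𝒞' + ρ' = d(f + log |det A|)` with `ρ' = ρ - ρ₀`. -/
theorem IsPrimitive.frameChange (g : Metric E Q) (hW : IsNaturalRealization W S)
    (hW' : IsNaturalRealization W' S) {ρ : ∀ q : Q, TangentSpace 𝓘(ℝ, E) q →L[ℝ] ℝ} {f : Q → ℝ}
    (hf : IsPrimitive f (fun q => densityForm g W q + ρ q)) :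
    IsPrimitive (fun q => f q + logDetFrame g W W' q)
      (fun q => densityForm g W' q + (ρ q - densityShift g W W' q)) := by
  have hlog := contMDiff_logDetFrame g hW hW'
  refine ⟨hf.1.add hlog, fun q => ?_⟩
  rw [dBase_add hf.1 hlog, ← hf.2 q]
  beta_reduce
  rw [densityForm_frameChange g hW hW' q]
  abel

theorem exists_exact_frameChange (g : Metric E Q) (hW : IsNaturalRealization W S)
    (hW' : IsNaturalRealization W' S)
    (h : ∃ ρ : ∀ q : Q, TangentSpace 𝓘(ℝ, E) q →L[ℝ] ℝ, IsAnnihilatorSection g S ρ ∧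
      IsExactForm (fun q => densityForm g W q + ρ q)) :
    ∃ ρ : ∀ q : Q, TangentSpace 𝓘(ℝ, E) q →L[ℝ] ℝ, IsAnnihilatorSection g S ρ ∧
      IsExactForm (fun q => densityForm g W' q + ρ q) := by
  obtain ⟨ρ, hρ, f, hf⟩ := h
  exact ⟨_, hρ.sub (isAnnihilatorSection_densityShift g hW hW'), _, hf.frameChange g hW hW'⟩

omit [NormedAddCommGroup E] [NormedSpace ℝ E] [ChartedSpace E Q] [IsManifold 𝓘(ℝ, E) ∞ Q] in
theorem isLocallyConstant_sign {d : Q → ℝ} (hd : Continuous d) (h0 : ∀ q, d q ≠ 0) :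
    IsLocallyConstant fun q => Real.sign (d q) := by
  rw [IsLocallyConstant.iff_eventually_eq]
  intro q
  rcases lt_or_gt_of_ne (h0 q) with h | h
  · filter_upwards [hd.continuousAt.eventually_lt continuousAt_const h] with x hx
    rw [Real.sign_of_neg hx, Real.sign_of_neg h]
  · filter_upwards [continuousAt_const.eventually_lt hd.continuousAt h] with x hx
    rw [Real.sign_of_pos hx, Real.sign_of_pos h]

/-- `Real.log` is `log |·|`, so its exponential loses the sign of `d`; this is the source of the
function `s`. -/
theorem sign_mul_exp_log {d : ℝ} (hd : d ≠ 0) : Real.sign d * Real.exp (Real.log d) = d := by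
  rw [Real.exp_log_eq_abs hd]
  rcases lt_or_gt_of_ne hd with h | h
  · rw [Real.sign_of_neg h, abs_of_neg h]; ring
  · rw [Real.sign_of_pos h, abs_of_pos h, one_mul]

variable [FiniteDimensional ℝ E]

theorem nhVolume_frameChange_exp (g : Metric E Q) {V : Q → ℝ}
    (hV : ContMDiff 𝓘(ℝ, E) 𝓘(ℝ, ℝ) ∞ V) (hW : IsNaturalRealization W S)
    (hW' : IsNaturalRealization W' S) {ρ ρ' : ∀ q : Q, TangentSpace 𝓘(ℝ, E) q →L[ℝ] ℝ}
    {f f' : Q → ℝ} (hρ : IsAnnihilatorSection g S ρ) (hρ' : IsAnnihilatorSection g S ρ')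
    (hf : IsPrimitive f (fun q => densityForm g W q + ρ q))
    (hf' : IsPrimitive f' (fun q => densityForm g W' q + ρ' q)) :
    ∃ (s : Q → ℝ) (c : CotangentBundle E Q → ℝ),
      IsLocallyConstant s ∧ (∀ q, s q = 1 ∨ s q = -1) ∧
      ContMDiff (cotangentModel E) 𝓘(ℝ, ℝ) ∞ c ∧ IsConstantOfMotion g V S c ∧
      ∀ k : ℕ, m + k = 2 * Module.finrank ℝ E → ∀ z ∈ S,
        Real.exp (f z.1) • nhVolume W S k z =
          (s z.1 * Real.exp (c z) * Real.exp (f' z.1)) • nhVolume W' S k z := by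
  have hdet := det_frameMatrix_ne_zero g hW hW'
  have hF := hf.frameChange g hW hW'
  refine ⟨fun q => Real.sign (frameMatrix g W W' q).det,
    fun z => f z.1 + logDetFrame g W W' z.1 - f' z.1,
    isLocallyConstant_sign (contMDiff_det (contMDiff_frameMatrix g hW hW')).continuous hdet,
    fun q => (Real.sign_apply_eq_of_ne_zero _ (hdet q)).symm,
    (hF.1.sub hf'.1).comp (contMDiff_proj _), ?_, ?_⟩
  · refine isConstantOfMotion_comp_proj (F := fun q => f q + logDetFrame g W W' q - f' q) hV
      (hF.1.sub hf'.1) fun q v hv => ?_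
    -- Both primitives now belong to `W'`, so `ϑ'` cancels and `dc = ρ - densityShift - ρ'`, each
    -- term of which annihilates `𝒟`.
    rw [dBase_sub hF.1 hf'.1, ← hF.2 q, ← hf'.2 q, add_sub_add_left_eq_sub, _root_.sub_apply,
      _root_.sub_apply, hρ.2 q v hv, hρ'.2 q v hv,
      (isAnnihilatorSection_densityShift g hW hW').2 q v hv]
    simp
  · intro k hd z hz
    rw [nhVolume_frameChange g hW hW' hd hz, smul_smul]
    congr 1
    rw [Real.exp_sub, Real.exp_add, logDetFrame]
    conv_lhs => rw [← sign_mul_exp_log (hdet z.1)]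
    field_simp

end Exactness

end Nonholonomic

end

theorem mainTheorem2
    {E : Type*} [NormedAddCommGroup E] [NormedSpace ℝ E] [FiniteDimensional ℝ E]
    {Q : Type*} [TopologicalSpace Q] [ChartedSpace E Q] [IsManifold 𝓘(ℝ, E) ∞ Q]
    (g : Nonholonomic.Metric E Q)
    (V : Q → ℝ) (hV : ContMDiff 𝓘(ℝ, E) 𝓘(ℝ, ℝ) ∞ V)
    (S : Set (Nonholonomic.CotangentBundle E Q))
    {m m' : ℕ} (W : Fin m → ∀ q : Q, TangentSpace 𝓘(ℝ, E) q)
    (W' : Fin m' → ∀ q : Q, TangentSpace 𝓘(ℝ, E) q)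
    (hW : Nonholonomic.IsNaturalRealization W S)
    (hW' : Nonholonomic.IsNaturalRealization W' S) :
    ((∃ ρ : ∀ q : Q, TangentSpace 𝓘(ℝ, E) q →L[ℝ] ℝ,
        Nonholonomic.IsAnnihilatorSection g S ρ ∧
          Nonholonomic.IsExactForm (fun q => Nonholonomic.densityForm g W q + ρ q)) ↔
      ∃ ρ' : ∀ q : Q, TangentSpace 𝓘(ℝ, E) q →L[ℝ] ℝ,
        Nonholonomic.IsAnnihilatorSection g S ρ' ∧
          Nonholonomic.IsExactForm (fun q => Nonholonomic.densityForm g W' q + ρ' q)) ∧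
    ∀ (ρ ρ' : ∀ q : Q, TangentSpace 𝓘(ℝ, E) q →L[ℝ] ℝ) (f f' : Q → ℝ),
      Nonholonomic.IsAnnihilatorSection g S ρ → Nonholonomic.IsAnnihilatorSection g S ρ' →
      Nonholonomic.IsPrimitive f (fun q => Nonholonomic.densityForm g W q + ρ q) →
      Nonholonomic.IsPrimitive f' (fun q => Nonholonomic.densityForm g W' q + ρ' q) →
      ∃ (s : Q → ℝ) (c : Nonholonomic.CotangentBundle E Q → ℝ),
        IsLocallyConstant s ∧ (∀ q, s q = 1 ∨ s q = -1) ∧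
        ContMDiff (Nonholonomic.cotangentModel E) 𝓘(ℝ, ℝ) ∞ c ∧
        Nonholonomic.IsConstantOfMotion g V S c ∧
        ∀ k : ℕ, m + k = 2 * Module.finrank ℝ E → ∀ z ∈ S,
          Real.exp (f z.1) • Nonholonomic.nhVolume W S k z =
            (s z.1 * Real.exp (c z) * Real.exp (f' z.1)) • Nonholonomic.nhVolume W' S k z := by
  rcases isEmpty_or_nonempty Q with hQ | hQ
  -- Over the empty manifold `m` and `m'` may differ, but all forms are exact and every pointwise
  -- claim is vacuous.
  · have hexact : ∀ α : ∀ q : Q, TangentSpace 𝓘(ℝ, E) q →L[ℝ] ℝ, Nonholonomic.IsExactForm α :=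
      fun α => ⟨0, contMDiff_const, fun q => isEmptyElim q⟩
    have hann : ∀ ρ : ∀ q : Q, TangentSpace 𝓘(ℝ, E) q →L[ℝ] ℝ,
        Nonholonomic.IsAnnihilatorSection g S ρ :=
      fun ρ => ⟨fun q => isEmptyElim q, fun q => isEmptyElim q⟩
    refine ⟨⟨fun _ => ⟨0, hann _, hexact _⟩, fun _ => ⟨0, hann _, hexact _⟩⟩, ?_⟩
    intro _ _ _ _ _ _ _ _
    exact ⟨fun _ => 1, fun _ => 0, IsLocallyConstant.const 1, fun _ => Or.inl rfl,
      contMDiff_const, fun z => isEmptyElim z.1, fun _ _ z => isEmptyElim z.1⟩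
  · obtain rfl : m = m' := le_antisymm (hW'.card_le g hW) (hW.card_le g hW')
    exact ⟨⟨Nonholonomic.exists_exact_frameChange g hW hW',
      Nonholonomic.exists_exact_frameChange g hW' hW⟩,
      fun _ _ _ _ hρ hρ' hf hf' => Nonholonomic.nhVolume_frameChange_exp g hV hW hW' hρ hρ' hf hf'⟩
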